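/- Let $k$ be a field of characteristic zero, let $H$ be a finite-dimensional semisimple Hopf algebra over $k$ with coproduct $\Delta(h)=\sum h_{1}\otimes h_{2}$ and counit $\varepsilon$, and let $A$ be a left $H$-module algebra over $k$ that is noetherian on both sides. Let $B=A\#H$ be the smash product, that is, $A\otimes_k H$ with multiplication $(a\#h)(b\#g)=\sum a(h_{1}\cdot b)\#h_{2}g$. Let $R=A^H=\{a\in A: h\cdot a=\varepsilon(h)a \text{ for all } h\in H\}$, and let $t\in H$ be a nonzero integral, that is, $t\ne 0$ and $ht=\varepsilon(h)t$ for all $h\in H$. For an algebra $E$, let $\operatorname{Mod}E$ be the category of right $E$-modules, $\operatorname{Tor}E$ its full subcategory of modules $M$ such that $mE$ is finite dimensional for every $m\in M$, and $\operatorname{QMod}E=\operatorname{Mod}E/\operatorname{Tor}E$ the quotient category, that is, the localization of $\operatorname{Mod}E$ at the morphisms with kernel and cokernel in $\operatorname{Tor}E$. For a right $B$-module $M$, a submodule $N\subseteq M$ is called $t$-torsion if $m(A\#t)$ is finite dimensional for every $m\in N$, and $T(M)$ denotes the sum of all $t$-torsion submodules of $M$. Let $AtA$ be the two-sided ideal of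 $B$ generated by $t$. Let $\rho:A\to A\otimes H^*$, $\rho(b)=\sum b_{(0)}\otimes b_{(1)}$, be the coaction with $h\cdot b=\sum b_{(1)}(h)b_{(0)}$ for all $h\in H$. The extension $A/R$ is called a right $H^*$-dense Galois extension if the map $\beta:A\otimes_R A\to A\otimes H^*$, $a\otimes b\mapsto (a\otimes 1)\rho(b)$, has finite-dimensional cokernel. View $A$ as a $(B,R)$-bimodule, where $(a\#h)\cdot b=a(h\cdot b)$ and $R$ acts by right multiplication. Then $-\otimes_B A:\operatorname{Mod}B\to\operatorname{Mod}R$ induces a functor $\operatorname{QMod}B\to\operatorname{QMod}R$, denoted $-\otimes_{\mathcal B}\mathcal A$, and the following are equivalent: (i) $A/R$ is a right $H^*$-dense Galois extension; (ii) for every finitely generated right $B$-module $M$, $T(M)$ is finite dimensional; (iii) $B/(AtA)$ is finite dimensional; (iv) $-\otimes_{\mathcal B}\mathcal A:\operatorname{QMod}B\to\operatorname{QMod}R$ is an equivalence of abelian categories. -/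

import Mathlib

universe u v w

open CategoryTheory CategoryTheory.Limits MulOpposite
open scoped TensorProduct

set_option linter.unusedSectionVars false

noncomputable section

/-! ### Module algebras, invariants, integrals -/

section ModuleAlgebra

variable (k : Type u) (H : Type v) (A : Type w) [Field k] [Ring H] [Bialgebra k H]
  [Ring A] [Algebra k A] [Module H A] [IsScalarTower k H A]

/-- The action map `H → End_k(A)`, `h ↦ (a ↦ h • a)`. -/
def actionMap : H →ₗ[k] A →ₗ[k] A := (Algebra.lsmul k k A : H →ₐ[k] Module.End k A).toLinearMap

@[simp] theorem actionMap_apply (h : H) (a : A) : actionMap k H A h a = h • a := rfl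

/-- An algebra `A` that is a left `H`-module is a left `H`-module algebra if
`h • 1 = ε(h) 1` and `h • (a b) = ∑ (h₁ • a) (h₂ • b)`, where `Δ(h) = ∑ h₁ ⊗ h₂`. -/
class IsModuleAlgebra : Prop where
  smul_one' (h : H) : h • (1 : A) = Coalgebra.counit (R := k) h • (1 : A)
  smul_mul' (h : H) (a b : A) : h • (a * b) =
    LinearMap.mul' k A (TensorProduct.map ((actionMap k H A).flip a) ((actionMap k H A).flip b)
      (Coalgebra.comul (R := k) h))

variable {H A}

theorem IsModuleAlgebra.smul_mul_repr [IsModuleAlgebra k H A] {ι : Type*} {h : H}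
    (r : Coalgebra.Repr k h ι) (a b : A) :
    h • (a * b) = ∑ i ∈ r.index, (r.left i • a) * (r.right i • b) := by
  rw [IsModuleAlgebra.smul_mul' (k := k), ← r.eq]
  simp

theorem IsModuleAlgebra.smul_mul_of_invariant [IsModuleAlgebra k H A] {r : A}
    (hr : ∀ h : H, h • r = Coalgebra.counit (R := k) h • r) (h : H) (b : A) :
    h • (r * b) = r * (h • b) := by
  have e := Coalgebra.sum_counit_smul (Coalgebra.Repr.arbitrary k h)
  rw [smul_mul_repr k (Coalgebra.Repr.arbitrary k h)]
  conv_rhs => rw [← e]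
  simp [hr, Finset.sum_smul, Finset.mul_sum]

theorem IsModuleAlgebra.smul_mul_of_invariant_right [IsModuleAlgebra k H A] {r : A}
    (hr : ∀ h : H, h • r = Coalgebra.counit (R := k) h • r) (h : H) (b : A) :
    h • (b * r) = (h • b) * r := by
  have e := Coalgebra.sum_map_tmul_counit_eq (repr := Coalgebra.Repr.arbitrary k h)
    ((actionMap k H A).flip b) h
  have e' := congrArg (TensorProduct.rid k A) e
  rw [smul_mul_repr k (Coalgebra.Repr.arbitrary k h)]
  simp only [map_sum, TensorProduct.rid_tmul, LinearMap.flip_apply, actionMap_apply,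
    one_smul] at e'
  rw [← e', Finset.sum_mul]
  simp [hr]

variable (H A)

/-- The invariant subalgebra `A^H = {a ∈ A | h • a = ε(h) a for all h ∈ H}`. -/
def invariantSubalgebra [IsModuleAlgebra k H A] : Subalgebra k A where
  carrier := {a | ∀ h : H, h • a = Coalgebra.counit (R := k) h • a}
  mul_mem' {a b} ha hb h := by
    rw [IsModuleAlgebra.smul_mul_of_invariant k ha, hb h, mul_smul_comm]
  add_mem' {a b} ha hb h := by rw [smul_add, ha h, hb h, smul_add]
  algebraMap_mem' c h := by
    rw [Algebra.algebraMap_eq_smul_one, smul_comm, IsModuleAlgebra.smul_one' (k := k), smul_comm]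

end ModuleAlgebra

/-- `t ∈ H` is a (left) integral if `h t = ε(h) t` for all `h ∈ H`. -/
def IsIntegralElement (k : Type u) {H : Type v} [Field k] [Ring H] [Bialgebra k H] (t : H) : Prop :=
  ∀ h : H, h * t = Coalgebra.counit (R := k) h • t

/-! ### The smash product -/

/-- The vector space underlying the smash product `A # H`. -/
def SmashProduct (k : Type u) (A : Type w) (H : Type v) [Field k] [Ring H] [Bialgebra k H]
    [Ring A] [Algebra k A] : Type (max w v) := A ⊗[k] H

namespace SmashProduct

section

variable (k : Type u) (A : Type w) (H : Type v) [Field k] [Ring H] [Bialgebra k H]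
  [Ring A] [Algebra k A]

instance : AddCommGroup (SmashProduct k A H) := inferInstanceAs (AddCommGroup (A ⊗[k] H))

instance : Module k (SmashProduct k A H) := inferInstanceAs (Module k (A ⊗[k] H))

variable {A H}

/-- The element `a # h` of `A # H`. -/
def mk (a : A) (h : H) : SmashProduct k A H := a ⊗ₜ[k] h

theorem induction {p : SmashProduct k A H → Prop} (h0 : p 0) (hmk : ∀ a h, p (mk k a h))
    (hadd : ∀ x y, p x → p y → p (x + y)) (x : SmashProduct k A H) : p x :=
  TensorProduct.induction_on (motive := p) x h0 hmk hadd

theorem hom_ext {M : Type*} [AddCommMonoid M] [Module k M] {f g : SmashProduct k A H →ₗ[k] M}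
    (h : ∀ a b, f (mk k a b) = g (mk k a b)) : f = g :=
  TensorProduct.ext' h

variable (A H) in
/-- `mk` as a bilinear map. -/
def mkₗ : A →ₗ[k] H →ₗ[k] SmashProduct k A H := TensorProduct.mk k A H

@[simp] theorem mkₗ_apply (a : A) (h : H) : mkₗ k A H a h = mk k a h := rfl

variable [Module H A] [IsScalarTower k H A]

/-- For `h ∈ H`, `a b ∈ A`, `g ∈ H`: the element `∑ a (h₁ • b) # h₂ g`. -/
def mulAux (a : A) (h : H) (b : A) (g : H) : SmashProduct k A H :=
  TensorProduct.map ((LinearMap.mulLeft k a) ∘ₗ (actionMap k H A).flip b) (LinearMap.mulRight k g)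
    (Coalgebra.comul (R := k) h)

theorem mulAux_repr {ι : Type*} {h : H} (r : Coalgebra.Repr k h ι) (a b : A) (g : H) :
    mulAux k a h b g = ∑ i ∈ r.index, mk k (a * (r.left i • b)) (r.right i * g) := by
  rw [mulAux, ← r.eq, map_sum]
  rfl

/-- Left multiplication by `a # h` on `A # H`, as a linear map. -/
def mulLeftₗ (a : A) (h : H) : SmashProduct k A H →ₗ[k] SmashProduct k A H :=
  TensorProduct.lift (LinearMap.mk₂ k
    (fun (b : A) (g : H) => mulAux k a h b g)
    (fun b b' g => by
      simp [mulAux_repr k (Coalgebra.Repr.arbitrary k h), ← mkₗ_apply, smul_add, mul_add,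
        Finset.sum_add_distrib])
    (fun c b g => by
      simp [mulAux_repr k (Coalgebra.Repr.arbitrary k h), ← mkₗ_apply, smul_comm _ c,
        Finset.smul_sum])
    (fun b g g' => by
      simp [mulAux_repr k (Coalgebra.Repr.arbitrary k h), ← mkₗ_apply, mul_add,
        Finset.sum_add_distrib])
    (fun c b g => by
      simp [mulAux_repr k (Coalgebra.Repr.arbitrary k h), ← mkₗ_apply, Finset.smul_sum]))

@[simp] theorem mulLeftₗ_mk (a : A) (h : H) (b : A) (g : H) :
    mulLeftₗ k a h (mk k b g) = mulAux k a h b g := rfl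

theorem mulAux_add (a : A) (h h' : H) (b : A) (g : H) :
    mulAux k a (h + h') b g = mulAux k a h b g + mulAux k a h' b g := by
  unfold mulAux
  rw [map_add, map_add]
  rfl

theorem mulAux_smul (c : k) (a : A) (h : H) (b : A) (g : H) :
    mulAux k a (c • h) b g = c • mulAux k a h b g := by
  unfold mulAux
  rw [map_smul, map_smul]
  rfl

variable (A H) in
/-- The multiplication of `A # H` as a bilinear map, determined by
`(a # h) (b # g) = ∑ a (h₁ • b) # h₂ g`. -/
def mulₗ : SmashProduct k A H →ₗ[k] SmashProduct k A H →ₗ[k] SmashProduct k A H :=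
  TensorProduct.lift (LinearMap.mk₂ k (mulLeftₗ k)
    (fun a a' h => hom_ext k fun b g => by
      rw [LinearMap.add_apply]
      simp only [mulLeftₗ_mk, mulAux_repr k (Coalgebra.Repr.arbitrary k h)]
      simp [← mkₗ_apply, add_mul, Finset.sum_add_distrib])
    (fun c a h => hom_ext k fun b g => by
      rw [LinearMap.smul_apply]
      simp only [mulLeftₗ_mk, mulAux_repr k (Coalgebra.Repr.arbitrary k h)]
      simp [← mkₗ_apply, Finset.smul_sum])
    (fun a h h' => hom_ext k fun b g => by simp [mulAux_add])
    (fun c a h => hom_ext k fun b g => by simp [mulAux_smul]))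

instance : Mul (SmashProduct k A H) := ⟨fun x y => mulₗ k A H x y⟩

instance : One (SmashProduct k A H) := ⟨mk k 1 1⟩

theorem mul_def (x y : SmashProduct k A H) : x * y = mulₗ k A H x y := rfl

theorem one_def : (1 : SmashProduct k A H) = mk k 1 1 := rfl

theorem mk_mul_mk (a : A) (h : H) (b : A) (g : H) :
    mk k a h * mk k b g = mulAux k a h b g := rfl

/-- The defining formula `(a # h) (b # g) = ∑ a (h₁ • b) # h₂ g` of the smash product. -/
theorem mk_mul_mk_repr {ι : Type*} {h : H} (r : Coalgebra.Repr k h ι) (a b : A) (g : H) :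
    mk k a h * mk k b g = ∑ i ∈ r.index, mk k (a * (r.left i • b)) (r.right i * g) :=
  mulAux_repr k r a b g

theorem sum_mul' {ι : Type*} (s : Finset ι) (f : ι → SmashProduct k A H)
    (y : SmashProduct k A H) : (∑ i ∈ s, f i) * y = ∑ i ∈ s, f i * y := by
  simp [mul_def]

theorem mul_sum' {ι : Type*} (s : Finset ι) (f : ι → SmashProduct k A H)
    (y : SmashProduct k A H) : y * (∑ i ∈ s, f i) = ∑ i ∈ s, y * f i := by
  simp [mul_def]

variable [IsModuleAlgebra k H A]

variable (A) in
theorem comul_repr_mul {ι κ : Type*} {y g : H} (r : Coalgebra.Repr k y ι)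
    (s : Coalgebra.Repr k g κ) :
    Coalgebra.comul (R := k) (y * g) = ∑ i ∈ r.index, ∑ j ∈ s.index,
      (r.left i * s.left j) ⊗ₜ[k] (r.right i * s.right j) := by
  rw [Bialgebra.comul_mul, ← r.eq, ← s.eq, Finset.sum_mul_sum]
  simp

theorem mk_mul_assoc (a b c : A) (h g l : H) :
    mk k a h * mk k b g * mk k c l = mk k a h * (mk k b g * mk k c l) := by
  let rh := Coalgebra.Repr.arbitrary k h
  let rg := Coalgebra.Repr.arbitrary k g
  let r1 := fun i => Coalgebra.Repr.arbitrary k (rh.left i)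
  let r2 := fun i => Coalgebra.Repr.arbitrary k (rh.right i)
  have key : ∀ u v : H, ∑ i ∈ rh.index, ∑ j ∈ (r1 i).index,
      mk k (a * (((r1 i).left j • b) * (((r1 i).right j * u) • c))) (rh.right i * v * l) =
      ∑ i ∈ rh.index, ∑ j ∈ (r2 i).index,
      mk k (a * ((rh.left i • b) * (((r2 i).left j * u) • c))) ((r2 i).right j * v * l) := by
    intro u v
    let Φ : H ⊗[k] (H ⊗[k] H) →ₗ[k] A ⊗[k] H :=
      TensorProduct.map (LinearMap.mulLeft k a ∘ₗ LinearMap.mul' k A ∘ₗ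
        TensorProduct.map ((actionMap k H A).flip b)
          ((actionMap k H A).flip c ∘ₗ LinearMap.mulRight k u))
        (LinearMap.mulRight k l ∘ₗ LinearMap.mulRight k v) ∘ₗ
      (TensorProduct.assoc k H H H).symm.toLinearMap
    have := congrArg Φ (Coalgebra.sum_tmul_tmul_eq rh r1 r2)
    simp only [map_sum] at this
    exact this
  have hL : mk k a h * mk k b g * mk k c l = ∑ i ∈ rh.index, ∑ j ∈ (r2 i).index,
      ∑ p ∈ rg.index, mk k (a * (rh.left i • b) * (((r2 i).left j * rg.left p) • c))
        ((r2 i).right j * rg.right p * l) := by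
    rw [mk_mul_mk_repr k rh, sum_mul']
    refine Finset.sum_congr rfl fun i _ => ?_
    rw [mk_mul_mk, mulAux, comul_repr_mul k (r2 i) rg]
    simp only [map_sum]
    rfl
  have hR : mk k a h * (mk k b g * mk k c l) = ∑ p ∈ rg.index, ∑ i ∈ rh.index,
      ∑ j ∈ (r1 i).index,
      mk k (a * (((r1 i).left j • b) * (((r1 i).right j * rg.left p) • c)))
        (rh.right i * rg.right p * l) := by
    rw [mk_mul_mk_repr k rg, mul_sum']
    refine Finset.sum_congr rfl fun p _ => ?_
    rw [mk_mul_mk_repr k rh]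
    refine Finset.sum_congr rfl fun i _ => ?_
    rw [IsModuleAlgebra.smul_mul_repr k (r1 i), Finset.mul_sum]
    simp only [← mkₗ_apply, map_sum, LinearMap.sum_apply, mul_smul, mul_assoc]
  rw [hL, hR]
  simp only [key]
  rw [Finset.sum_comm]
  refine Finset.sum_congr rfl fun i _ => ?_
  rw [Finset.sum_comm]
  simp only [mul_assoc]

instance : Ring (SmashProduct k A H) :=
  { (inferInstance : AddCommGroup (SmashProduct k A H)),
    (inferInstance : Mul (SmashProduct k A H)),
    (inferInstance : One (SmashProduct k A H)) with
    left_distrib := fun x y z => by simp [mul_def]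
    right_distrib := fun x y z => by simp [mul_def]
    zero_mul := fun x => by simp [mul_def]
    mul_zero := fun x => by simp [mul_def]
    mul_assoc := fun x y z => by
      induction x using SmashProduct.induction with
      | h0 => simp [mul_def]
      | hadd x x' hx hx' => simp only [mul_def, map_add, LinearMap.add_apply] at *; rw [hx, hx']
      | hmk a h =>
      induction y using SmashProduct.induction with
      | h0 => simp [mul_def]
      | hadd x x' hx hx' => simp only [mul_def, map_add, LinearMap.add_apply] at *; rw [hx, hx']
      | hmk b g =>
      induction z using SmashProduct.induction with
      | h0 => simp [mul_def]
      | hadd x x' hx hx' => simp only [mul_def, map_add] at *; rw [hx, hx']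
      | hmk c l => exact mk_mul_assoc k a b c h g l
    one_mul := fun x => by
      induction x using SmashProduct.induction with
      | h0 => simp [mul_def]
      | hadd x x' hx hx' => simp only [mul_def, map_add] at *; rw [hx, hx']
      | hmk b g =>
        rw [one_def, mk_mul_mk, mulAux, Bialgebra.comul_one, Algebra.TensorProduct.one_def,
          TensorProduct.map_tmul]
        simp
        rfl
    mul_one := fun x => by
      induction x using SmashProduct.induction with
      | h0 => simp [mul_def]
      | hadd x x' hx hx' =>
        simp only [mul_def, map_add, LinearMap.add_apply] at *; rw [hx, hx']
      | hmk a h =>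
        let r := Coalgebra.Repr.arbitrary k h
        have e := Coalgebra.sum_counit_smul r
        rw [one_def, mk_mul_mk_repr k r]
        conv_rhs => rw [← e]
        simp only [IsModuleAlgebra.smul_one' (k := k), mul_one, ← mkₗ_apply, map_sum, map_smul,
          LinearMap.smul_apply, mul_smul_comm] }

instance : Algebra k (SmashProduct k A H) :=
  Algebra.ofModule (fun c x y => by simp [mul_def]) (fun c x y => by simp [mul_def])

variable (A H) in
/-- The action of `A # H` on `A` as a bilinear map, determined by `(a # h) • b = a (h • b)`. -/
def actₗ : SmashProduct k A H →ₗ[k] A →ₗ[k] A :=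
  TensorProduct.lift (LinearMap.mk₂ k (fun a h => LinearMap.mulLeft k a ∘ₗ actionMap k H A h)
    (fun a a' h => LinearMap.ext fun b => by simp [add_mul])
    (fun c a h => LinearMap.ext fun b => by simp)
    (fun a h h' => LinearMap.ext fun b => by simp [mul_add])
    (fun c a h => LinearMap.ext fun b => by simp))

@[simp] theorem actₗ_mk (a : A) (h : H) (b : A) : actₗ k A H (mk k a h) b = a * (h • b) := rfl

/-- `A` as a left module over `A # H`, through `(a # h) • b = a (h • b)`. -/
instance : Module (SmashProduct k A H) A where
  smul x b := actₗ k A H x b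
  one_smul b := by change actₗ k A H (mk k 1 1) b = b; simp
  mul_smul x y c := by
    change actₗ k A H (x * y) c = actₗ k A H x (actₗ k A H y c)
    induction x using SmashProduct.induction with
    | h0 => simp
    | hadd x x' hx hx' => simp only [add_mul, map_add, LinearMap.add_apply, hx, hx']
    | hmk a h =>
    induction y using SmashProduct.induction with
    | h0 => simp
    | hadd x x' hx hx' => simp only [mul_add, map_add, LinearMap.add_apply, hx, hx']
    | hmk b g =>
      rw [mk_mul_mk_repr k (Coalgebra.Repr.arbitrary k h), actₗ_mk, actₗ_mk,
        IsModuleAlgebra.smul_mul_repr k (Coalgebra.Repr.arbitrary k h)]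
      simp [Finset.mul_sum, mul_smul, mul_assoc]
  smul_zero x := by change actₗ k A H x 0 = 0; simp
  smul_add x b c := by change actₗ k A H x (b + c) = actₗ k A H x b + actₗ k A H x c; simp
  add_smul x y b := by change actₗ k A H (x + y) b = actₗ k A H x b + actₗ k A H y b; simp
  zero_smul b := by change actₗ k A H 0 b = 0; simp

theorem smul_def (x : SmashProduct k A H) (b : A) : x • b = actₗ k A H x b := rfl

instance : IsScalarTower k (SmashProduct k A H) A :=
  ⟨fun c x b => by simp [smul_def]⟩

/-- `A` as a right module over `A^H`, by multiplication. -/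
instance : Module (invariantSubalgebra k H A)ᵐᵒᵖ A :=
  Module.compHom A (RingHom.op (invariantSubalgebra k H A).val.toRingHom)

theorem invariant_op_smul (r : invariantSubalgebra k H A) (a : A) : op r • a = a * (r : A) := rfl

instance : IsScalarTower k (invariantSubalgebra k H A)ᵐᵒᵖ A :=
  ⟨fun c r a => by
    induction r using MulOpposite.rec'
    rename_i r
    rw [← op_smul, invariant_op_smul, invariant_op_smul]
    simp⟩

/-- `A` is an `(A # H, A^H)`-bimodule. -/
instance : SMulCommClass (invariantSubalgebra k H A)ᵐᵒᵖ (SmashProduct k A H) A :=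
  ⟨fun r x a => by
    induction r using MulOpposite.rec'
    rename_i r
    rw [invariant_op_smul, invariant_op_smul, smul_def, smul_def]
    induction x using SmashProduct.induction with
    | h0 => simp
    | hadd x x' hx hx' => simp only [map_add, LinearMap.add_apply, add_mul, hx, hx']
    | hmk b h =>
      rw [actₗ_mk, actₗ_mk, IsModuleAlgebra.smul_mul_of_invariant_right k r.2, mul_assoc]⟩

end

end SmashProduct

/-! ### Tensor products over a noncommutative algebra -/

section BalancedTensor

variable (k : Type u) (E : Type v) (M N : Type*) [Field k] [Ring E] [Algebra k E]
  [AddCommGroup M] [Module k M] [Module Eᵐᵒᵖ M] [IsScalarTower k Eᵐᵒᵖ M]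
  [AddCommGroup N] [Module k N] [Module E N] [IsScalarTower k E N]

/-- The subspace of `M ⊗_k N` spanned by the elements `m e ⊗ n - m ⊗ e n`. -/
def balancingRelations : Submodule k (M ⊗[k] N) :=
  Submodule.span k {x | ∃ (m : M) (e : E) (n : N), x = (op e • m) ⊗ₜ[k] n - m ⊗ₜ[k] (e • n)}

/-- The tensor product `M ⊗_E N` of a right `E`-module and a left `E`-module over a
(not necessarily commutative) `k`-algebra `E`. -/
def BalancedTensor : Type _ := (M ⊗[k] N) ⧸ balancingRelations k E M N

namespace BalancedTensor

instance : AddCommGroup (BalancedTensor k E M N) :=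
  inferInstanceAs (AddCommGroup ((M ⊗[k] N) ⧸ balancingRelations k E M N))

instance : Module k (BalancedTensor k E M N) :=
  inferInstanceAs (Module k ((M ⊗[k] N) ⧸ balancingRelations k E M N))

/-- The projection `M ⊗_k N → M ⊗_E N`. -/
def proj : M ⊗[k] N →ₗ[k] BalancedTensor k E M N := (balancingRelations k E M N).mkQ

variable {M N}

/-- The pure tensor `m ⊗ n` in `M ⊗_E N`. -/
def tmul (m : M) (n : N) : BalancedTensor k E M N := proj k E M N (m ⊗ₜ[k] n)

theorem tmul_balanced (m : M) (e : E) (n : N) :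
    tmul k E (op e • m) n = tmul k E m (e • n) := by
  rw [tmul, tmul, ← sub_eq_zero, ← map_sub]
  exact (Submodule.Quotient.mk_eq_zero _).2 (Submodule.subset_span ⟨m, e, n, rfl⟩)

variable {k E} in
theorem hom_ext {P : Type*} [AddCommGroup P] [Module k P] {f g : BalancedTensor k E M N →ₗ[k] P}
    (h : ∀ m n, f (tmul k E m n) = g (tmul k E m n)) : f = g :=
  Submodule.linearMap_qext _ (TensorProduct.ext' h)

/-- The linear map out of `M ⊗_E N` induced by an `E`-balanced bilinear map. -/
def lift {P : Type*} [AddCommGroup P] [Module k P] (f : M →ₗ[k] N →ₗ[k] P)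
    (hf : ∀ (m : M) (e : E) (n : N), f (op e • m) n = f m (e • n)) :
    BalancedTensor k E M N →ₗ[k] P :=
  (balancingRelations k E M N).liftQ (TensorProduct.lift f) (by
    rw [balancingRelations, Submodule.span_le]
    rintro _ ⟨m, e, n, rfl⟩
    simp [hf])

@[simp] theorem lift_tmul {P : Type*} [AddCommGroup P] [Module k P] (f : M →ₗ[k] N →ₗ[k] P)
    (hf : ∀ (m : M) (e : E) (n : N), f (op e • m) n = f m (e • n)) (m : M) (n : N) :
    lift k E f hf (tmul k E m n) = f m n := rfl

/-- The map `f ⊗ g : M ⊗_E N → M' ⊗_E N'`. -/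
def map {M' N' : Type*} [AddCommGroup M'] [Module k M'] [Module Eᵐᵒᵖ M'] [IsScalarTower k Eᵐᵒᵖ M']
    [AddCommGroup N'] [Module k N'] [Module E N'] [IsScalarTower k E N']
    (f : M →ₗ[Eᵐᵒᵖ] M') (g : N →ₗ[E] N') :
    BalancedTensor k E M N →ₗ[k] BalancedTensor k E M' N' :=
  lift k E ((((TensorProduct.mk k M' N').compr₂ (proj k E M' N')).compl₁₂
      (f.restrictScalars k) (g.restrictScalars k)))
    (fun m e n => by
      have := tmul_balanced k E (f m) e (g n)
      simpa [tmul] using this)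

@[simp] theorem map_tmul {M' N' : Type*} [AddCommGroup M'] [Module k M'] [Module Eᵐᵒᵖ M']
    [IsScalarTower k Eᵐᵒᵖ M'] [AddCommGroup N'] [Module k N'] [Module E N'] [IsScalarTower k E N']
    (f : M →ₗ[Eᵐᵒᵖ] M') (g : N →ₗ[E] N') (m : M) (n : N) :
    map k E f g (tmul k E m n) = tmul k E (f m) (g n) := rfl

/-- The action of `s ∈ S` on `M ⊗_E N` for a bimodule `N`, as a ring homomorphism. -/
def actionHom (M N : Type*) (S : Type*) [Ring S]
    [AddCommGroup M] [Module k M] [Module Eᵐᵒᵖ M] [IsScalarTower k Eᵐᵒᵖ M]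
    [AddCommGroup N] [Module k N] [Module E N] [IsScalarTower k E N]
    [Module S N] [SMulCommClass S E N] :
    S →+* Module.End k (BalancedTensor k E M N) where
  toFun s := map k E LinearMap.id (DistribSMul.toLinearMap E N s)
  map_one' := hom_ext fun m n => by simp
  map_mul' s s' := hom_ext fun m n => by simp [mul_smul]
  map_zero' := hom_ext fun m n => by rw [map_tmul]; simp [tmul]
  map_add' s s' := hom_ext fun m n => by
    rw [LinearMap.add_apply]
    simp only [map_tmul]
    simp [tmul, add_smul, TensorProduct.tmul_add]

/-- If the left `E`-module `N` carries a commuting action of `S`, then so does `M ⊗_E N`, through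
`s • (m ⊗ n) = m ⊗ (s • n)`. For a right action of `F` on `N`, take `S = Fᵐᵒᵖ`. -/
abbrev bimoduleModule (M N : Type*) (S : Type*) [Ring S]
    [AddCommGroup M] [Module k M] [Module Eᵐᵒᵖ M] [IsScalarTower k Eᵐᵒᵖ M]
    [AddCommGroup N] [Module k N] [Module E N] [IsScalarTower k E N]
    [Module S N] [SMulCommClass S E N] : Module S (BalancedTensor k E M N) :=
  Module.compHom _ (actionHom k E M N S)

end BalancedTensor

end BalancedTensor

/-! ### Dense Galois extensions -/

section DenseGalois

variable (k : Type u) (H : Type v) (A : Type w) [Field k] [Ring H] [Bialgebra k H]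
  [FiniteDimensional k H] [Ring A] [Algebra k A] [Module H A] [IsScalarTower k H A]

/-- The right coaction `ρ : A → A ⊗ H*` corresponding to the left action of the finite-dimensional
`H` on `A`: if `ρ(a) = ∑ a₀ ⊗ a₁`, then `h • a = ∑ a₁(h) a₀` for all `h ∈ H`. -/
def dualCoaction : A →ₗ[k] A ⊗[k] Module.Dual k H :=
  (TensorProduct.comm k (Module.Dual k H) A).toLinearMap ∘ₗ
    (dualTensorHomEquiv k H A).symm.toLinearMap ∘ₗ (actionMap k H A).flip

variable [IsModuleAlgebra k H A]

theorem dualCoaction_invariant_mul (r : invariantSubalgebra k H A) (b : A) :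
    dualCoaction k H A ((r : A) * b) =
      (LinearMap.mulLeft k (r : A)).rTensor (Module.Dual k H) (dualCoaction k H A b) := by
  have key : ∀ x : Module.Dual k H ⊗[k] A, dualTensorHom k H A
      ((LinearMap.mulLeft k (r : A)).lTensor (Module.Dual k H) x) =
      LinearMap.mulLeft k (r : A) ∘ₗ dualTensorHom k H A x := by
    intro x
    induction x with
    | zero => simp
    | add x y hx hy => simp only [map_add, hx, hy, LinearMap.comp_add]
    | tmul f a => ext h; simp
  have hc : ∀ x : Module.Dual k H ⊗[k] A, TensorProduct.comm k (Module.Dual k H) A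
      ((LinearMap.mulLeft k (r : A)).lTensor (Module.Dual k H) x) =
      (LinearMap.mulLeft k (r : A)).rTensor (Module.Dual k H)
        (TensorProduct.comm k (Module.Dual k H) A x) := by
    intro x
    induction x with
    | zero => simp
    | add x y hx hy => simp only [map_add, hx, hy]
    | tmul f a => simp
  simp only [dualCoaction, LinearMap.comp_apply, LinearEquiv.coe_coe]
  rw [← hc]
  congr 1
  rw [LinearEquiv.symm_apply_eq]
  have := key ((dualTensorHomEquiv k H A).symm ((actionMap k H A).flip b))
  have e : ∀ x, dualTensorHomEquiv k H A x = dualTensorHom k H A x := fun x => rfl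
  rw [e, this, ← e, LinearEquiv.apply_symm_apply]
  ext h
  simp [IsModuleAlgebra.smul_mul_of_invariant k r.2]

/-- The canonical map `β : A ⊗_R A → A ⊗ H*`, `a ⊗ b ↦ (a ⊗ 1) ρ(b)`, where `R = A^H`. -/
def canonicalMap :
    BalancedTensor k (invariantSubalgebra k H A) A A →ₗ[k] A ⊗[k] Module.Dual k H :=
  BalancedTensor.lift k (invariantSubalgebra k H A)
    (LinearMap.mk₂ k
      (fun a b => (LinearMap.mulLeft k a).rTensor (Module.Dual k H) (dualCoaction k H A b))
      (fun a a' b => by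
        rw [← LinearMap.add_apply, ← LinearMap.rTensor_add]; congr 2; ext; simp [add_mul])
      (fun c a b => by
        rw [← LinearMap.smul_apply, ← LinearMap.rTensor_smul]; congr 2; ext; simp)
      (fun a b b' => by simp)
      (fun c a b => by simp))
    (fun a r b => by
      rw [SmashProduct.invariant_op_smul, LinearMap.mk₂_apply, LinearMap.mk₂_apply]
      change _ = (LinearMap.mulLeft k a).rTensor (Module.Dual k H)
        (dualCoaction k H A ((r : A) * b))
      rw [dualCoaction_invariant_mul, LinearMap.mulLeft_mul, LinearMap.rTensor_comp,
        LinearMap.comp_apply])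

/-- `A / A^H` is a right `H*`-dense Galois extension: the canonical map
`β : A ⊗_{A^H} A → A ⊗ H*` is almost surjective, i.e. its cokernel is finite dimensional. -/
def IsDenseGalois : Prop :=
  FiniteDimensional k ((A ⊗[k] Module.Dual k H) ⧸ LinearMap.range (canonicalMap k H A))

end DenseGalois

/-! ### Torsion modules and quotient categories

Right modules over an algebra `E` are modules over `Eᵐᵒᵖ`. -/

section Torsion

open scoped ModuleCat

variable (k : Type u) (E : Type v) [Field k] [Ring E] [Algebra k E]

/-- The torsion modules: the right `E`-modules `M` such that `m E` is finite dimensional for every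
`m ∈ M`. -/
def torsionModules : ObjectProperty (ModuleCat.{w} Eᵐᵒᵖ) :=
  fun M => ∀ m : M, FiniteDimensional k (Submodule.span Eᵐᵒᵖ {m})

/-- The morphisms of right `E`-modules whose kernel and cokernel are torsion modules. -/
def isoModTorsion : MorphismProperty (ModuleCat.{w} Eᵐᵒᵖ) :=
  fun _ _ f => torsionModules k E (kernel f) ∧ torsionModules k E (cokernel f)

theorem isoModTorsion_eq_isoModSerre [(torsionModules.{u, v, w} k E).IsSerreClass] :
    isoModTorsion.{u, v, w} k E = (torsionModules.{u, v, w} k E).isoModSerre := rfl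

/-- The quotient category `QMod E = Mod E / Tor E`: the localization of the category of right
`E`-modules at the morphisms with torsion kernel and torsion cokernel. -/
abbrev QMod := (isoModTorsion.{u, v, w} k E).Localization

/-- The projection functor `π : Mod E ⥤ QMod E`. -/
abbrev QMod.proj : ModuleCat.{w} Eᵐᵒᵖ ⥤ QMod.{u, v, w} k E := (isoModTorsion.{u, v, w} k E).Q

end Torsion

section TensorFunctor

open scoped ModuleCat

/-- For an `(E, F)`-bimodule `N`, the functor `- ⊗_E N : Mod E ⥤ Mod F` on right modules. -/
def tensorFunctor (k : Type u) (E F : Type v) [Field k] [Ring E] [Algebra k E] [Ring F]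
    (N : Type v) [AddCommGroup N] [Module k N] [Module E N] [IsScalarTower k E N]
    [Module Fᵐᵒᵖ N] [SMulCommClass Fᵐᵒᵖ E N] :
    ModuleCat.{v} Eᵐᵒᵖ ⥤ ModuleCat.{v} Fᵐᵒᵖ where
  obj M :=
    letI := BalancedTensor.bimoduleModule k E M N Fᵐᵒᵖ
    ModuleCat.of Fᵐᵒᵖ (BalancedTensor k E M N)
  map {M M'} f :=
    letI := BalancedTensor.bimoduleModule k E M N Fᵐᵒᵖ
    letI := BalancedTensor.bimoduleModule k E M' N Fᵐᵒᵖ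
    ModuleCat.ofHom
      { toFun := BalancedTensor.map k E f.hom LinearMap.id
        map_add' := map_add _
        map_smul' := fun s x => LinearMap.congr_fun (BalancedTensor.hom_ext
          (f := BalancedTensor.map k E f.hom LinearMap.id ∘ₗ
            BalancedTensor.actionHom k E M N Fᵐᵒᵖ s)
          (g := BalancedTensor.actionHom k E M' N Fᵐᵒᵖ s ∘ₗ
            BalancedTensor.map k E f.hom LinearMap.id) fun _ _ => rfl) x }
  map_id M := by
    let := BalancedTensor.bimoduleModule k E M N Fᵐᵒᵖ
    apply ModuleCat.hom_ext
    apply LinearMap.ext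
    intro x
    exact LinearMap.congr_fun (BalancedTensor.hom_ext
      (f := BalancedTensor.map k E (𝟙 M : M ⟶ M).hom (LinearMap.id : N →ₗ[E] N))
      (g := LinearMap.id) fun _ _ => rfl) x
  map_comp {M M' M''} f g := by
    let := BalancedTensor.bimoduleModule k E M N Fᵐᵒᵖ
    let := BalancedTensor.bimoduleModule k E M'' N Fᵐᵒᵖ
    apply ModuleCat.hom_ext
    apply LinearMap.ext
    intro x
    exact LinearMap.congr_fun (BalancedTensor.hom_ext
      (f := BalancedTensor.map k E (f ≫ g).hom (LinearMap.id : N →ₗ[E] N))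
      (g := BalancedTensor.map k E g.hom LinearMap.id ∘ₗ
        BalancedTensor.map k E f.hom LinearMap.id) fun _ _ => rfl) x

end TensorFunctor

/-! ### `t`-torsion modules over the smash product -/

section TTorsion

variable (k : Type u) {A : Type w} {H : Type v} [Field k] [Ring H] [Bialgebra k H]
  [Ring A] [Algebra k A] [Module H A] [IsScalarTower k H A] [IsModuleAlgebra k H A] (t : H)
  (M : Type*) [AddCommGroup M] [Module k M] [Module (SmashProduct k A H)ᵐᵒᵖ M]

/-- A submodule `N` of a right `A # H`-module is `t`-torsion if `m (A # t)` is finite dimensional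
for every `m ∈ N`. -/
def IsTTorsion {M : Type*} [AddCommGroup M] [Module k M] [Module (SmashProduct k A H)ᵐᵒᵖ M]
    (N : Submodule (SmashProduct k A H)ᵐᵒᵖ M) : Prop :=
  ∀ m ∈ N, FiniteDimensional k
    (Submodule.span k (Set.range fun a : A => op (SmashProduct.mk k a t) • m))

variable (A) in
/-- `T(M)`, the sum of all the `t`-torsion submodules of a right `A # H`-module `M`. -/
def tTorsionSubmodule : Submodule (SmashProduct k A H)ᵐᵒᵖ M :=
  sSup {N | IsTTorsion k t N}

variable (A) in
/-- `AtA`, the two-sided ideal of `A # H` generated by `t = 1 # t`. -/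
def integralIdeal : TwoSidedIdeal (SmashProduct k A H) :=
  TwoSidedIdeal.span {SmashProduct.mk k (1 : A) t}

end TTorsion

end

/-! ### Integrals and the antipode of a finite-dimensional Hopf algebra -/

section Integrals

open Coalgebra HopfAlgebra

/-! Semisimplicity gives a two-sided integral `e` with ε(e) = 1, and t = ε(t)e with ε(t) ≠ 0, so `t`
may be replaced by `e`. Then 1 # e is an idempotent of B = A # H, again written e. Every condition
is compared with (iii), the finite dimensionality of B / BeB.

(i) ⇔ (iii): for a nonzero integral the map H* → H, f ↦ ∑ f(e₁) e₂, is bijective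
(`IsIntegralElement.dualToLeg_bijective`). Tensored with A it carries (a ⊗ 1)ρ(b) to (a # e)(b # 1),
hence the image of β onto BeB, and the cokernel of β becomes B / BeB
(`SmashProduct.isDenseGalois_iff`).

(ii) ⇔ (iii): B is noetherian on both sides, so T(M) is finitely generated when M is. T(M)e is
always finite dimensional for such M, and over B with B / BeB finite dimensional this forces T(M) to
be so (`IsIdempotentElem.finiteDimensional_of_range`). Conversely the cyclic module B / BeB is its
own `t`-torsion part.

(iii) ⇒ (iv): A is isomorphic to the left ideal Be = A # e, so M ⊗_B A is Me, and eBe is the image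
of R = A^H. Hence F = - ⊗_B A always preserves morphisms with torsion kernel and cokernel. Under
(iii) it also reflects them. Its right adjoint Hom_R(A, -) is fully faithful, so F is a
localization. F followed by Mod R → QMod R is then a localization of Mod B at the very class that
defines QMod B, and localizations are unique.

(iv) ⇒ (iii): F kills B / BeB, so an equivalence forces this module to vanish in QMod B. Torsion
modules form a Serre class, so the cyclic module B / BeB is torsion, that is, finite dimensional. -/

theorem Coalgebra.sum_counit_smul_left {k C ι : Type*} [CommSemiring k] [AddCommMonoid C]
    [Module k C] [Coalgebra k C] {a : C} (r : Repr k a ι) :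
    ∑ i ∈ r.index, counit (R := k) (r.right i) • r.left i = a := by
  have := congrArg (_root_.TensorProduct.rid k C) (sum_tmul_counit_eq r)
  simpa only [map_sum, _root_.TensorProduct.rid_tmul, one_smul] using this

/-- Split 1 = z + e along a left ideal complement J of ker f. Since ker f is two-sided, (ker f)e
lies in ker f ∩ J = 0. For f = ε this produces an integral. -/
theorem IsSemisimpleRing.exists_map_eq_one_of_ker_mul {R K : Type*} [Ring R] [CommRing K]
    [IsSemisimpleRing R] (f : R →+* K) : ∃ e : R, f e = 1 ∧ ∀ h, f h = 0 → h * e = 0 := by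
  obtain ⟨J, hJ⟩ := exists_isCompl (RingHom.ker f : Ideal R)
  obtain ⟨z, hz, e, he, h1⟩ := Submodule.mem_sup.1 (hJ.sup_eq_top ▸
    Submodule.mem_top (x := (1 : R)))
  have hz' : f z = 0 := hz
  refine ⟨e, by rw [← map_one f, ← h1, map_add, hz', zero_add], fun h hh => ?_⟩
  have : h * e ∈ (RingHom.ker f : Ideal R) ⊓ J :=
    ⟨by simp [RingHom.mem_ker, hh], J.mul_mem_left h he⟩
  rwa [hJ.inf_eq_bot] at this

variable {k : Type u} {H : Type v} [Field k] [Ring H]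

/-- In a semisimple bialgebra there is a normalized two-sided integral. -/
theorem exists_normalized_integral (k : Type u) (H : Type v) [Field k] [Ring H] [Bialgebra k H]
    [IsSemisimpleRing H] :
    ∃ e : H, IsIntegralElement k e ∧ (∀ h, e * h = counit (R := k) h • e) ∧
      counit (R := k) e = 1 := by
  have hs (h : H) : counit (R := k) (h - counit (R := k) h • (1 : H)) = 0 := by simp
  obtain ⟨e, he1, he⟩ := IsSemisimpleRing.exists_map_eq_one_of_ker_mul
    (Bialgebra.counitAlgHom k H : H →+* k)
  -- The same lemma over the opposite ring yields a right integral of counit 1.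
  obtain ⟨e', he1', he'⟩ := IsSemisimpleRing.exists_map_eq_one_of_ker_mul
    ((Bialgebra.counitAlgHom k H : H →+* k).fromOpposite fun _ _ => Commute.all _ _)
  have hl : IsIntegralElement k e := fun h => by
    have := he _ (hs h)
    rwa [sub_mul, smul_one_mul, sub_eq_zero] at this
  have hr (h : H) : unop e' * h = counit (R := k) h • unop e' := by
    have := congrArg unop (he' (op (h - counit (R := k) h • (1 : H))) (hs h))
    rwa [unop_mul, unop_op, MulOpposite.unop_zero, mul_sub, mul_smul_one, sub_eq_zero] at this
  have h1 : counit (R := k) e = 1 := he1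
  have h1' : counit (R := k) (unop e') = 1 := he1'
  -- With e' now read in H: e = ε(e')e = e'e = ε(e)e' = e'.
  have : e = unop e' := by
    rw [← one_smul k e, ← h1', ← hl, hr, h1, one_smul]
  exact ⟨e, hl, by rwa [this], h1⟩

theorem IsIntegralElement.eq_counit_smul [Bialgebra k H] {e t : H}
    (he : ∀ h, e * h = counit (R := k) h • e) (he1 : counit (R := k) e = 1)
    (ht : IsIntegralElement k t) : t = counit (R := k) t • e := by
  rw [← he, ht, he1, one_smul]

variable [HopfAlgebra k H]

/-- Inserting ∑ S(h₂)h₃ turns ∑ h t₁ ⊗ S(t₂) into ∑ h₁t₁ ⊗ S(h₂t₂)h₃, and Δ(h₁t) = ε(h₁)Δ(t)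
collapses the latter to ∑ t₁ ⊗ S(t₂)h. -/
theorem IsIntegralElement.sum_mul_tmul_antipode {t : H} (ht : IsIntegralElement k t) {ι : Type*}
    (r : Repr k t ι) (h : H) :
    ∑ i ∈ r.index, (h * r.left i) ⊗ₜ[k] antipode k (r.right i) =
      ∑ i ∈ r.index, r.left i ⊗ₜ[k] (antipode k (r.right i) * h) := by
  let s := Repr.arbitrary k h
  let s1 := fun j => Repr.arbitrary k (s.left j)
  let s2 := fun j => Repr.arbitrary k (s.right j)
  have e1 (j) : ∑ p ∈ (s1 j).index, ∑ i ∈ r.index,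
      ((s1 j).left p * r.left i) ⊗ₜ[k] ((s1 j).right p * r.right i) =
      ∑ i ∈ r.index, (counit (R := k) (s.left j) • r.left i) ⊗ₜ[k] r.right i := by
    have := congrArg (comul (R := k)) (ht (s.left j))
    rw [Bialgebra.comul_mul, ← (s1 j).eq, map_smul, ← r.eq, Finset.sum_mul_sum] at this
    simpa [Finset.smul_sum, TensorProduct.smul_tmul'] using this
  have e2 (j) := congrArg (TensorProduct.map (LinearMap.id : H →ₗ[k] H)
    (LinearMap.mulRight k (s.right j) ∘ₗ antipode k)) (e1 j)
  simp only [map_sum, TensorProduct.map_tmul, LinearMap.id_apply, LinearMap.comp_apply,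
    LinearMap.mulRight_apply, antipode_mul_antidistrib] at e2
  have key (i) : ∑ j ∈ s.index, ∑ p ∈ (s1 j).index, ((s1 j).left p * r.left i) ⊗ₜ[k]
      (antipode k (r.right i) * antipode k ((s1 j).right p) * s.right j) =
      (h * r.left i) ⊗ₜ[k] antipode k (r.right i) := by
    let Φ : H ⊗[k] (H ⊗[k] H) →ₗ[k] H ⊗[k] H :=
      TensorProduct.map (LinearMap.mulRight k (r.left i))
        (LinearMap.mulLeft k (antipode k (r.right i)) ∘ₗ LinearMap.mul' k H ∘ₗ
          TensorProduct.map (antipode k) LinearMap.id)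
    have := congrArg Φ (sum_tmul_tmul_eq s s1 s2)
    simp only [map_sum, Φ, TensorProduct.map_tmul, LinearMap.comp_apply, LinearMap.mulRight_apply,
      LinearMap.mulLeft_apply, LinearMap.mul'_apply, LinearMap.id_apply, ← mul_assoc] at this
    rw [this]
    simp only [mul_assoc, ← TensorProduct.tmul_sum, ← Finset.mul_sum, sum_antipode_mul_eq_smul,
      mul_smul_comm, mul_one]
    simp only [← TensorProduct.smul_tmul, ← smul_mul_assoc, ← TensorProduct.sum_tmul,
      ← Finset.sum_mul]
    rw [sum_counit_smul_left]
  calc _ = ∑ i ∈ r.index, ∑ j ∈ s.index, ∑ p ∈ (s1 j).index, ((s1 j).left p * r.left i) ⊗ₜ[k]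
      (antipode k (r.right i) * antipode k ((s1 j).right p) * s.right j) := by simp only [key]
    _ = ∑ j ∈ s.index, ∑ i ∈ r.index, (counit (R := k) (s.left j) • r.left i) ⊗ₜ[k]
        (antipode k (r.right i) * s.right j) := by
      rw [Finset.sum_comm]
      refine Finset.sum_congr rfl fun j _ => ?_
      rw [Finset.sum_comm, e2]
    _ = _ := by
      rw [Finset.sum_comm]
      refine Finset.sum_congr rfl fun i _ => ?_
      simp only [TensorProduct.smul_tmul, ← mul_smul_comm, ← TensorProduct.tmul_sum,
        ← Finset.mul_sum, sum_counit_smul]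

variable [FiniteDimensional k H]

/-- A nondegeneracy statement, from which bijectivity of the antipode and of `dualToLeg` both
follow. Left multiplication by h moves into `f`, so ∑ f(S(t₂)h)t₁ = 0 for all h; applying S² to a
further leg of `t` then recovers f(z)t. -/
theorem IsIntegralElement.eq_zero_of_sum_antipode {t : H} (ht : IsIntegralElement k t)
    (ht0 : t ≠ 0) {ι : Type*} (r : Repr k t ι) {f : Module.Dual k H}
    (hf : ∑ i ∈ r.index, f (antipode k (r.right i)) • r.left i = 0) : f = 0 := by
  ext z
  have h1 (h : H) : ∑ i ∈ r.index, f (antipode k (r.right i) * h) • r.left i = 0 := by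
    have := congrArg ((TensorProduct.rid k H).toLinearMap ∘ₗ TensorProduct.map LinearMap.id f)
      (ht.sum_mul_tmul_antipode r h)
    simp only [map_sum, LinearMap.comp_apply, TensorProduct.map_tmul, LinearEquiv.coe_coe,
      TensorProduct.rid_tmul, LinearMap.id_apply] at this
    rw [← this]
    simp only [← mul_smul_comm, ← Finset.mul_sum, hf, mul_zero]
  have h2 : ∑ i ∈ r.index, (f ∘ₗ LinearMap.mulLeft k (antipode k (r.right i))) ⊗ₜ[k] r.left i
      = 0 := by
    apply (dualTensorHomEquiv k H H).injective
    ext h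
    simpa using h1 h
  let r1 := fun i => Repr.arbitrary k (r.left i)
  let r2 := fun i => Repr.arbitrary k (r.right i)
  have h3 (i) : ∑ p ∈ (r1 i).index, f (antipode k (r.right i) *
      (antipode k (antipode k ((r1 i).right p)) * z)) • (r1 i).left p =
      ∑ p ∈ (r1 i).index, (TensorProduct.rid k H) ((r1 i).left p ⊗ₜ[k] f (antipode k (r.right i) *
      (antipode k (antipode k ((r1 i).right p)) * z))) := by simp
  -- Ψ(φ ⊗ l) = ∑ φ(S²(l₂)z)l₁. On the vanishing tensor `h2` it gives ∑ f(S(t₃)S²(t₂)z)t₁ = ∑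
  -- f(S(S(t₂)t₃)z)t₁ = f(z)t.
  let Ψ : Module.Dual k H ⊗[k] H →ₗ[k] H := TensorProduct.lift (LinearMap.mk₂ k
    (fun φ l => TensorProduct.rid k H (TensorProduct.map LinearMap.id
      (φ ∘ₗ LinearMap.mulRight k z ∘ₗ antipode k ∘ₗ antipode k) (comul (R := k) l)))
    (fun φ φ' l => by rw [LinearMap.add_comp, TensorProduct.map_add_right]; simp)
    (fun c φ l => by rw [LinearMap.smul_comp, TensorProduct.map_smul_right]; simp)
    (fun φ l l' => by simp) (fun c φ l => by simp))
  have h4 := congrArg Ψ h2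
  have h5 (i) : Ψ ((f ∘ₗ LinearMap.mulLeft k (antipode k (r.right i))) ⊗ₜ[k] r.left i) =
      ∑ p ∈ (r1 i).index, f (antipode k (r.right i) *
      (antipode k (antipode k ((r1 i).right p)) * z)) • (r1 i).left p := by
    simp only [Ψ, TensorProduct.lift.tmul, LinearMap.mk₂_apply]
    rw [← (r1 i).eq]
    simp
  simp only [map_sum, h5, map_zero] at h4
  let Ω : H ⊗[k] (H ⊗[k] H) →ₗ[k] H := (TensorProduct.rid k H).toLinearMap ∘ₗ
    TensorProduct.map LinearMap.id (f ∘ₗ LinearMap.mulRight k z ∘ₗ antipode k ∘ₗ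
      LinearMap.mul' k H ∘ₗ TensorProduct.map (antipode k) LinearMap.id)
  have h6 := congrArg Ω (sum_tmul_tmul_eq r r1 r2)
  simp only [map_sum, Ω, TensorProduct.map_tmul, LinearMap.comp_apply, LinearMap.mulRight_apply,
    LinearMap.mul'_apply, LinearMap.id_apply, LinearEquiv.coe_coe, TensorProduct.rid_tmul] at h6
  simp only [antipode_mul_antidistrib, mul_assoc] at h6
  rw [h4] at h6
  simp only [← antipode_mul_antidistrib, ← mul_assoc, ← Finset.sum_smul, ← map_sum,
    ← Finset.sum_mul, sum_antipode_mul_eq_smul] at h6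
  simp only [map_smul, antipode_one, smul_mul_assoc, one_mul, smul_assoc] at h6
  simp only [smul_comm _ (f z), ← Finset.smul_sum, sum_counit_smul_left] at h6
  exact (smul_eq_zero.1 h6.symm).resolve_right ht0

/-- A functional that vanishes on the image of S satisfies the nondegeneracy hypothesis trivially,
so it is zero; injectivity follows by dimension. -/
theorem IsIntegralElement.antipode_bijective {t : H} (ht : IsIntegralElement k t) (ht0 : t ≠ 0) :
    Function.Bijective (antipode k (A := H)) := by
  have hs : Function.Surjective (antipode k (A := H)) := by
    rw [← LinearMap.range_eq_top]
    by_contra h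
    obtain ⟨f, hf0, hf⟩ := Submodule.exists_le_ker_of_lt_top _ (lt_top_iff_ne_top.2 h)
    refine hf0 (ht.eq_zero_of_sum_antipode ht0 (Repr.arbitrary k t)
      (Finset.sum_eq_zero fun i _ => ?_))
    rw [show f (antipode k _) = 0 from hf ⟨_, rfl⟩, zero_smul]
  exact ⟨LinearMap.injective_iff_surjective.2 hs, hs⟩

/-- The map `H* → H`, `f ↦ ∑ f(t₁) t₂`. -/
def dualToLeg (k : Type u) {H : Type v} [Field k] [Ring H] [Bialgebra k H] (t : H) :
    Module.Dual k H →ₗ[k] H where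
  toFun f := TensorProduct.lid k H (f.rTensor H (comul (R := k) t))
  map_add' f g := by simp [LinearMap.rTensor_add]
  map_smul' c f := by simp [LinearMap.rTensor_smul]

theorem dualToLeg_apply {k : Type u} {H : Type v} [Field k] [Ring H] [Bialgebra k H] {t : H}
    {ι : Type*} (r : Repr k t ι) (f : Module.Dual k H) :
    dualToLeg k t f = ∑ i ∈ r.index, f (r.left i) • r.right i := by
  change TensorProduct.lid k H (f.rTensor H (comul (R := k) t)) = _
  rw [← r.eq]
  simp

/-- If g kills the image then ∑ g(t₂)t₁ = 0. Writing g = (g ∘ S⁻¹) ∘ S, nondegeneracy gives g ∘ S⁻¹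
= 0. -/
theorem IsIntegralElement.dualToLeg_bijective {t : H} (ht : IsIntegralElement k t) (ht0 : t ≠ 0) :
    Function.Bijective (dualToLeg k t) := by
  have hs : Function.Surjective (dualToLeg k t) := by
    rw [← LinearMap.range_eq_top]
    by_contra h
    obtain ⟨g, hg0, hg⟩ := Submodule.exists_le_ker_of_lt_top _ (lt_top_iff_ne_top.2 h)
    let r := Repr.arbitrary k t
    let σ := LinearEquiv.ofBijective _ (ht.antipode_bijective ht0)
    have h1 : ∑ i ∈ r.index, g (r.right i) • r.left i = 0 := by
      rw [← Module.forall_dual_apply_eq_zero_iff k]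
      intro f
      have := hg ⟨f, rfl⟩
      rw [LinearMap.mem_ker, dualToLeg_apply r] at this
      simpa [mul_comm] using this
    have h2 : g ∘ₗ σ.symm.toLinearMap = 0 := by
      refine ht.eq_zero_of_sum_antipode ht0 r ?_
      have (x : H) : σ.symm (antipode k x) = x := σ.symm_apply_apply x
      simpa [this] using h1
    apply hg0
    ext x
    simpa using LinearMap.congr_fun h2 (σ x)
  refine ⟨?_, hs⟩
  rwa [LinearMap.injective_iff_surjective_of_finrank_eq_finrank Subspace.dual_finrank_eq]

/-- If `H` has a nonzero integral, then the antipode has an inverse `S'`, which satisfies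
`∑ h₂ S'(h₁) = ε(h)`. -/
theorem IsIntegralElement.exists_inverse_antipode {t : H} (ht : IsIntegralElement k t)
    (ht0 : t ≠ 0) :
    ∃ S' : H →ₗ[k] H, ∀ (h : H) {ι : Type v} (r : Repr k h ι),
      ∑ i ∈ r.index, r.right i * S' (r.left i) = counit (R := k) h • 1 := by
  let σ := LinearEquiv.ofBijective _ (ht.antipode_bijective ht0)
  -- After applying the injective antimultiplicative S, the identity becomes ∑ h₁S(h₂) = ε(h).
  refine ⟨σ.symm, fun h ι r => (ht.antipode_bijective ht0).1 ?_⟩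
  have (x : H) : antipode k (σ.symm x) = x := σ.apply_symm_apply x
  simp [antipode_mul_antidistrib, this, sum_mul_antipode_eq_smul]

end Integrals

/-! ### Two-sided ideals generated by one element -/

section SpanMulMul

variable (k : Type*) {B : Type*} [Field k] [Ring B] [Algebra k B]

/-- The subspace of a `k`-algebra `B` spanned by the elements `b e b'`. -/
def spanMulMul (e : B) : Submodule k B := Submodule.span k {x | ∃ b b', x = b * e * b'}

theorem mul_mul_mem_spanMulMul (e b b' : B) : b * e * b' ∈ spanMulMul k e :=
  Submodule.subset_span ⟨b, b', rfl⟩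

theorem mul_mem_spanMulMul_right {e x : B} (hx : x ∈ spanMulMul k e) (b : B) :
    x * b ∈ spanMulMul k e := by
  induction hx using Submodule.span_induction with
  | mem x hx =>
    obtain ⟨c, c', rfl⟩ := hx
    simpa [mul_assoc] using mul_mul_mem_spanMulMul k e c (c' * b)
  | zero => simp
  | add x y _ _ hx hy => rw [add_mul]; exact add_mem hx hy
  | smul c x _ hx => rw [smul_mul_assoc]; exact Submodule.smul_mem _ _ hx

theorem mem_twoSidedIdeal_span_singleton_iff {e x : B} :
    x ∈ TwoSidedIdeal.span {e} ↔ x ∈ spanMulMul k e := by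
  constructor
  · rw [TwoSidedIdeal.mem_span_iff_mem_addSubgroup_closure]
    intro hx
    induction hx using AddSubgroup.closure_induction with
    | mem x hx =>
      obtain ⟨_, ⟨b, -, _, rfl, rfl⟩, b', -, rfl⟩ := hx
      exact mul_mul_mem_spanMulMul k _ b b'
    | zero => exact zero_mem _
    | add x y _ _ hx hy => exact add_mem hx hy
    | neg x _ hx => exact neg_mem hx
  · intro hx
    induction hx using Submodule.span_induction with
    | mem x hx =>
      obtain ⟨b, b', rfl⟩ := hx
      exact TwoSidedIdeal.mul_mem_right _ _ _ (TwoSidedIdeal.mul_mem_left _ _ _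
        (TwoSidedIdeal.subset_span rfl))
    | zero => exact zero_mem _
    | add x y _ _ hx hy => exact add_mem hx hy
    | smul c x _ hx =>
      rw [← smul_one_mul]
      exact TwoSidedIdeal.mul_mem_left _ _ _ hx

/-- Trades the quotient ring for a quotient vector space, where complements and linear maps are
available. -/
theorem finiteDimensional_ringCon_quotient_iff (e : B) :
    FiniteDimensional k (TwoSidedIdeal.span {e}).ringCon.Quotient ↔
      FiniteDimensional k (B ⧸ spanMulMul k e) := by
  let f := (RingCon.mkₐ (α := k) (TwoSidedIdeal.span {e}).ringCon).toLinearMap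
  have hf : Function.Surjective f := RingCon.mkₐ_surjective (α := k) _
  have hk : LinearMap.ker f = spanMulMul k e := by
    ext x
    rw [← mem_twoSidedIdeal_span_singleton_iff, TwoSidedIdeal.mem_iff,
      LinearMap.mem_ker]
    exact RingCon.eq _
  rw [← hk]
  exact Module.Finite.equiv_iff (f.quotKerEquivOfSurjective hf).symm

theorem spanMulMul_smul {c : k} (hc : c ≠ 0) (e : B) : spanMulMul k (c • e) = spanMulMul k e := by
  apply le_antisymm <;> rw [spanMulMul, Submodule.span_le]
  · rintro _ ⟨b, b', rfl⟩
    simpa using Submodule.smul_mem _ c (mul_mul_mem_spanMulMul k e b b')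
  · rintro _ ⟨b, b', rfl⟩
    have := Submodule.smul_mem _ c⁻¹ (mul_mul_mem_spanMulMul k (c • e) b b')
    simpa [smul_smul, hc] using this

/-- The hypothesis makes T a finite left S-module through f. Being stated for a bare ring
homomorphism, it serves for A → A # H and for its opposite. -/
theorem isNoetherianRing_of_span_mul {S T : Type*} [Ring S] [Ring T] [IsNoetherianRing S]
    (f : S →+* T) {ι : Type*} [Finite ι] (g : ι → T)
    (h : ∀ x : T, x ∈ AddSubmonoid.closure {y | ∃ s i, y = f s * g i}) : IsNoetherianRing T := by
  let _ := Module.compHom T f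
  have : IsScalarTower S T T := ⟨fun s x y => mul_assoc (f s) x y⟩
  have : Module.Finite S T := by
    refine ⟨⟨(Set.finite_range g).toFinset, eq_top_iff.2 fun x _ => ?_⟩⟩
    induction h x using AddSubmonoid.closure_induction with
    | mem x hx =>
      obtain ⟨s, i, rfl⟩ := hx
      exact Submodule.smul_mem _ s (Submodule.subset_span (by simp))
    | zero => exact zero_mem _
    | add x y _ _ hx hy => exact add_mem (hx trivial) (hy trivial)
  exact isNoetherian_of_tower S inferInstance

end SpanMulMul

@[elab_as_elim]
theorem BalancedTensor.induction {k : Type*} {E : Type*} {M N : Type*} [Field k] [Ring E]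
    [Algebra k E] [AddCommGroup M] [Module k M] [Module Eᵐᵒᵖ M] [IsScalarTower k Eᵐᵒᵖ M]
    [AddCommGroup N] [Module k N] [Module E N] [IsScalarTower k E N]
    {p : BalancedTensor k E M N → Prop} (zero : p 0) (tmul : ∀ m n, p (tmul k E m n))
    (add : ∀ x y, p x → p y → p (x + y)) (x : BalancedTensor k E M N) : p x := by
  obtain ⟨z, rfl⟩ := Submodule.mkQ_surjective _ x
  induction z with
  | zero => rw [map_zero]; exact zero
  | tmul m n => exact tmul m n
  | add x y hx hy => rw [map_add]; exact add _ _ hx hy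

/-! ### Integrals in the smash product -/

namespace SmashProduct

open Coalgebra

section

variable (k : Type u) {A : Type w} {H : Type v} [Field k] [Ring H] [Bialgebra k H]
  [Ring A] [Algebra k A] [Module H A] [IsScalarTower k H A]

theorem mk_mul_mk_one [IsModuleAlgebra k H A] (a : A) (h g : H) :
    mk k a h * mk k (1 : A) g = mk k a (h * g) := by
  let r := Coalgebra.Repr.arbitrary k h
  rw [mk_mul_mk_repr k r]
  simp only [IsModuleAlgebra.smul_one' (k := k), mul_smul_comm, mul_one]
  conv_rhs => rw [← sum_counit_smul r]
  simp only [← mkₗ_apply, map_smul, LinearMap.smul_apply, Finset.sum_mul, map_sum, smul_mul_assoc]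

theorem mk_one_mul_mk (a b : A) (g : H) : mk k a (1 : H) * mk k b g = mk k (a * b) g := by
  rw [mk_mul_mk, mulAux, Bialgebra.comul_one, Algebra.TensorProduct.one_def,
    TensorProduct.map_tmul]
  simp only [LinearMap.comp_apply, LinearMap.flip_apply, actionMap_apply, one_smul,
    LinearMap.mulLeft_apply, LinearMap.mulRight_apply, one_mul]
  rfl

/-- Since h₂t = ε(h₂)t, the second leg disappears. Thus A # t is a left ideal on which B acts as it
does on A. -/
theorem mk_mul_mk_integral {t : H} (ht : IsIntegralElement k t) (a b : A) (h : H) :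
    mk k a h * mk k b t = mk k (a * (h • b)) t := by
  let r := Coalgebra.Repr.arbitrary k h
  rw [mk_mul_mk_repr k r]
  conv_rhs => rw [← sum_counit_smul_left r]
  simp only [ht _, ← mkₗ_apply, map_smul, Finset.sum_smul, Finset.mul_sum, map_sum, smul_assoc,
    mul_smul_comm, LinearMap.sum_apply, LinearMap.smul_apply]

variable [IsModuleAlgebra k H A]

/-- The right side expands to ∑ (h₂S'(h₁)) • a # h₃, and `hS'` removes the first two legs. This
moves H to the left of A, so that A # H is also spanned by products (1 # h)(a # 1). -/
theorem mk_eq_sum {S' : H →ₗ[k] H} (hS' : ∀ (h : H) {ι : Type v} (r : Repr k h ι),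
      ∑ i ∈ r.index, r.right i * S' (r.left i) = counit (R := k) h • 1)
    (a : A) {h : H} {ι : Type v} (r : Repr k h ι) :
    mk k a h = ∑ i ∈ r.index, mk k 1 (r.right i) * mk k (S' (r.left i) • a) 1 := by
  let r1 := fun i => Repr.arbitrary k (r.left i)
  let r2 := fun i => Repr.arbitrary k (r.right i)
  let Φ : H ⊗[k] (H ⊗[k] H) →ₗ[k] SmashProduct k A H :=
    TensorProduct.map ((actionMap k H A).flip a ∘ₗ LinearMap.mul' k H ∘ₗ
      (TensorProduct.comm k H H).toLinearMap ∘ₗ TensorProduct.map S' LinearMap.id) LinearMap.id ∘ₗ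
      (TensorProduct.assoc k H H H).symm.toLinearMap
  have hΦ (x y z : H) : Φ (x ⊗ₜ (y ⊗ₜ z)) = mk k ((y * S' x) • a) z := rfl
  have key := congrArg Φ (sum_tmul_tmul_eq r r1 r2)
  simp only [map_sum, hΦ] at key
  have h1 (i) : mk k 1 (r.right i) * mk k (S' (r.left i) • a) 1 = ∑ p ∈ (r2 i).index,
      mk k (((r2 i).left p * S' (r.left i)) • a) ((r2 i).right p) := by
    rw [mk_mul_mk_repr k (r2 i)]
    simp only [one_mul, mul_one, mul_smul]
  simp only [h1, ← key]
  conv_lhs => rw [← sum_counit_smul r]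
  simp only [← mkₗ_apply, ← map_sum, ← LinearMap.sum_apply, ← Finset.sum_smul, hS']
  simp

variable (A) in
/-- The map `A ⊗ H* → A # H`, `a ⊗ f ↦ a # ∑ f(t₁) t₂`. -/
def legMap (t : H) : A ⊗[k] Module.Dual k H →ₗ[k] SmashProduct k A H := (dualToLeg k t).lTensor A

/-- The map `A ⊗ H* → A # H`, `a ⊗ f ↦ a # ∑ f(t₁) t₂`, sends `(a ⊗ 1) ρ(b)` to
`(a # t) (b # 1)`. -/
theorem legMap_canonicalMap [FiniteDimensional k H] (t : H) (a b : A) :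
    legMap k A t
      (canonicalMap k H A (BalancedTensor.tmul k (invariantSubalgebra k H A) a b)) =
      mk k a t * mk k b 1 := by
  let r := Repr.arbitrary k t
  -- The coaction is defined by inverting `dualTensorHomEquiv`, so the formula is proved for an
  -- arbitrary tensor and then specialized.
  have h1 (x : Module.Dual k H ⊗[k] A) : legMap k A t
      ((LinearMap.mulLeft k a).rTensor (Module.Dual k H) (TensorProduct.comm k _ _ x)) =
      ∑ i ∈ r.index, mk k (a * dualTensorHom k H A x (r.left i)) (r.right i) := by
    induction x with
    | zero => simp [← mkₗ_apply]
    | add x y hx hy => simp only [map_add, hx, hy, LinearMap.add_apply, mul_add, ← mkₗ_apply,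
        Finset.sum_add_distrib]
    | tmul f c =>
      simp only [TensorProduct.comm_tmul, LinearMap.rTensor_tmul, LinearMap.mulLeft_apply,
        dualTensorHom_apply, ← mkₗ_apply, mul_smul_comm, map_smul, LinearMap.smul_apply]
      rw [show legMap k A t ((a * c) ⊗ₜ f) = mkₗ k A H (a * c) (dualToLeg k t f) from rfl,
        dualToLeg_apply r]
      simp
  rw [mk_mul_mk_repr k r]
  refine (h1 _).trans (Finset.sum_congr rfl fun i _ => ?_)
  have : dualTensorHom k H A ((dualTensorHomEquiv k H A).symm ((actionMap k H A).flip b)) =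
      (actionMap k H A).flip b := (dualTensorHomEquiv k H A).apply_symm_apply _
  rw [mul_one]
  exact congrArg (fun φ : H →ₗ[k] A => mk k (a * φ (r.left i)) (r.right i)) this

end

section

variable (k : Type u) (A : Type w) {H : Type v} [Field k] [Ring H] [HopfAlgebra k H]
  [FiniteDimensional k H] [Ring A] [Algebra k A] [Module H A] [IsScalarTower k H A]
  [IsModuleAlgebra k H A]

/-- In b t b' the H-part of b is absorbed by `t` on its left. The H-part of b' is first moved to the
left with `mk_eq_sum` and then absorbed on the right of `t`, which is where two-sidedness enters. -/
theorem spanMulMul_integral {t : H} (ht : IsIntegralElement k t) (ht0 : t ≠ 0)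
    (htr : ∀ h, t * h = counit (R := k) h • t) :
    spanMulMul k (mk k (1 : A) t) =
      Submodule.span k {x | ∃ a b : A, x = mk k a t * mk k b (1 : H)} := by
  obtain ⟨S', hS'⟩ := ht.exists_inverse_antipode ht0
  have hr (a b : A) (h : H) : mk k a t * mk k b h ∈
      Submodule.span k {x | ∃ a b : A, x = mk k a t * mk k b (1 : H)} := by
    rw [mk_eq_sum k hS' b (Repr.arbitrary k h), Finset.mul_sum]
    refine sum_mem fun i _ => ?_
    rw [← mul_assoc, mk_mul_mk_one, htr, ← mkₗ_apply, map_smul, smul_mul_assoc]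
    exact Submodule.smul_mem _ _ (Submodule.subset_span ⟨_, _, rfl⟩)
  apply le_antisymm <;> rw [spanMulMul, Submodule.span_le]
  · rintro _ ⟨b, b', rfl⟩
    induction b using SmashProduct.induction with
    | h0 => simp
    | hadd x y hx hy => rw [add_mul, add_mul]; exact add_mem hx hy
    | hmk a h =>
    induction b' using SmashProduct.induction with
    | h0 => simp
    | hadd x y hx hy => rw [mul_add]; exact add_mem hx hy
    | hmk b g =>
    rw [mk_mul_mk_one, ht, ← mkₗ_apply, map_smul, smul_mul_assoc]
    exact Submodule.smul_mem _ _ (hr _ _ _)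
  · rintro _ ⟨a, b, rfl⟩
    have := mul_mul_mem_spanMulMul k (mk k (1 : A) t) (mk k a 1) (mk k b 1)
    rwa [mk_one_mul_mk, mul_one] at this

/-- `θ` is bijective and carries the image of β onto the span of the (a # t)(b # 1), which is the
ideal; the two cokernels are therefore isomorphic. -/
theorem isDenseGalois_iff {t : H} (ht : IsIntegralElement k t) (ht0 : t ≠ 0)
    (htr : ∀ h, t * h = counit (R := k) h • t) :
    IsDenseGalois k H A ↔
      FiniteDimensional k (SmashProduct k A H ⧸ spanMulMul k (mk k (1 : A) t)) := by
  let θ : A ⊗[k] Module.Dual k H ≃ₗ[k] SmashProduct k A H :=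
    LinearEquiv.lTensor A (LinearEquiv.ofBijective _ (ht.dualToLeg_bijective ht0))
  have h : (LinearMap.range (canonicalMap k H A)).map (θ : _ →ₗ[k] SmashProduct k A H) =
      spanMulMul k (mk k (1 : A) t) := by
    rw [spanMulMul_integral k A ht ht0 htr, ← LinearMap.range_comp]
    apply le_antisymm
    · rintro _ ⟨z, rfl⟩
      induction z using BalancedTensor.induction with
      | zero => rw [map_zero]; exact zero_mem _
      | add x y hx hy => rw [map_add]; exact add_mem hx hy
      | tmul a b => exact Submodule.subset_span ⟨a, b, legMap_canonicalMap k t a b⟩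
    · rw [Submodule.span_le]
      rintro _ ⟨a, b, rfl⟩
      exact ⟨BalancedTensor.tmul k _ a b, legMap_canonicalMap k t a b⟩
  exact Module.Finite.equiv_iff (Submodule.Quotient.equiv _ _ θ h)

theorem isNoetherianRing [IsNoetherianRing A] : IsNoetherianRing (SmashProduct k A H) := by
  let f : A →+* SmashProduct k A H :=
    { toFun a := mk k a 1
      map_one' := rfl
      map_zero' := by simp [← mkₗ_apply]
      map_add' a b := by simp [← mkₗ_apply]
      map_mul' a b := by rw [mk_one_mul_mk] }
  let b := Module.finBasis k H
  refine isNoetherianRing_of_span_mul f (fun i => mk k 1 (b i)) fun x => ?_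
  induction x using SmashProduct.induction with
  | h0 => exact zero_mem _
  | hadd x y hx hy => exact add_mem hx hy
  | hmk a h =>
    rw [← b.sum_repr h, ← mkₗ_apply, map_sum]
    refine sum_mem fun i _ => AddSubmonoid.subset_closure ⟨b.repr h i • a, i, ?_⟩
    change _ = mk k _ 1 * mk k 1 _
    rw [mk_one_mul_mk, mul_one]
    simp [← mkₗ_apply]

/-- By `mk_eq_sum` a basis of H generates A # H as a right A-module. The integral is needed only to
invert the antipode. -/
theorem isNoetherianRing_op [IsNoetherianRing Aᵐᵒᵖ] {t : H} (ht : IsIntegralElement k t)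
    (ht0 : t ≠ 0) : IsNoetherianRing (SmashProduct k A H)ᵐᵒᵖ := by
  obtain ⟨S', hS'⟩ := ht.exists_inverse_antipode ht0
  let f : A →+* SmashProduct k A H :=
    { toFun a := mk k a 1
      map_one' := rfl
      map_zero' := by simp [← mkₗ_apply]
      map_add' a b := by simp [← mkₗ_apply]
      map_mul' a b := by rw [mk_one_mul_mk] }
  let b := Module.finBasis k H
  refine isNoetherianRing_of_span_mul f.op (fun i => op (mk k 1 (b i))) fun x => ?_
  induction x using MulOpposite.rec' with | _ x
  induction x using SmashProduct.induction with
  | h0 => exact zero_mem _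
  | hadd x y hx hy => exact add_mem hx hy
  | hmk a h =>
    rw [mk_eq_sum k hS' a (Repr.arbitrary k h), Finset.op_sum]
    refine sum_mem fun j _ => ?_
    generalize (Repr.arbitrary k h).right j = g
    generalize S' _ • a = a
    rw [← b.sum_repr g, ← mkₗ_apply, map_sum, Finset.sum_mul, Finset.op_sum]
    refine sum_mem fun i _ => AddSubmonoid.subset_closure ⟨op (b.repr g i • a), i, ?_⟩
    change _ = op (mk k _ 1) * op (mk k 1 _)
    rw [← op_mul]
    simp [← mkₗ_apply]

end

end SmashProduct

/-! ### Modules over a noetherian algebra with an idempotent -/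

section Idempotent

/-- So eB is a finitely generated left eBe-module: the left ideal BeB has finitely many generators c
in eB, and eb = ∑ x_c c may be multiplied by e on the left and rewritten using c = ec. -/
theorem IsIdempotentElem.exists_finset_mul_eq {B : Type*} [Ring B] [IsNoetherianRing B] {e : B}
    (he : IsIdempotentElem e) :
    ∃ C : Finset B, ∀ b, ∃ x : B → B, e * b = ∑ c ∈ C, e * x c * e * c := by
  classical
  obtain ⟨D, hD, hs⟩ := (Submodule.fg_span_iff_fg_span_finset_subset (R := B)
    (Set.range (e * ·))).1 (IsNoetherian.noetherian _)
  refine ⟨D, fun b => ?_⟩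
  have hb : e * b ∈ Submodule.span B (D : Set B) := hs ▸ Submodule.subset_span ⟨b, rfl⟩
  obtain ⟨x, -, hx⟩ := Submodule.mem_span_finset.1 hb
  refine ⟨x, ?_⟩
  rw [show e * b = e * (e * b) by rw [← mul_assoc, he.eq], ← hx, Finset.mul_sum]
  refine Finset.sum_congr rfl fun c hc => ?_
  obtain ⟨c, rfl⟩ := hD hc
  have : e * (e * c) = e * c := by rw [← mul_assoc, he.eq]
  simp only [smul_eq_mul, mul_assoc, this]

theorem IsIdempotentElem.exists_finset_eq_mul {B : Type*} [Ring B] [IsNoetherianRing Bᵐᵒᵖ] {e : B}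
    (he : IsIdempotentElem e) :
    ∃ C : Finset B, ∀ b, ∃ x : B → B, b * e = ∑ c ∈ C, c * (e * x c * e) := by
  classical
  have he' : IsIdempotentElem (op e) := congrArg op he.eq
  obtain ⟨C, hC⟩ := he'.exists_finset_mul_eq
  refine ⟨C.image unop, fun b => ?_⟩
  obtain ⟨x, hx⟩ := hC (op b)
  refine ⟨fun c => unop (x (op c)), op_injective ?_⟩
  rw [op_mul, hx, Finset.sum_image unop_injective.injOn, Finset.op_sum]
  simp [mul_assoc]

variable {k : Type*} {B : Type*} [Field k] [Ring B] [Algebra k B] {N : Type*} [AddCommGroup N]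
  [Module k N] [Module Bᵐᵒᵖ N] [IsScalarTower k Bᵐᵒᵖ N] {e : B}

/-- Let `e` be an idempotent of a left noetherian algebra `B` such that `B / BeB` is finite
dimensional. A finitely generated right `B`-module `N` such that `N e` is finite dimensional is
finite dimensional. -/
theorem IsIdempotentElem.finiteDimensional_of_range [IsNoetherianRing B]
    (he : IsIdempotentElem e) [FiniteDimensional k (B ⧸ spanMulMul k e)] [Module.Finite Bᵐᵒᵖ N]
    (hN : FiniteDimensional k (LinearMap.range (Algebra.lsmul k k N (op e)))) :
    FiniteDimensional k N := by
  classical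
  obtain ⟨C, hC⟩ := he.exists_finset_mul_eq
  obtain ⟨G, hG⟩ := Module.Finite.fg_top (R := Bᵐᵒᵖ) (M := N)
  obtain ⟨W, hW⟩ := (spanMulMul k e).exists_isCompl
  have : FiniteDimensional k W :=
    Module.Finite.equiv (Submodule.quotientEquivOfIsCompl _ _ hW)
  -- U is the sum of the spaces (Ne)c. It contains N·BeB because eB is generated by C over eBe. V is
  -- the sum of the gW, with W a finite-dimensional complement of BeB. Together they contain gB for
  -- every generator g.
  let U : Submodule k N := ⨆ c : C,
    (LinearMap.range (Algebra.lsmul k k N (op e))).map (Algebra.lsmul k k N (op c.1))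
  let V : Submodule k N := ⨆ g : G, W.map ((Algebra.lsmul k k N).toLinearMap.flip g.1 ∘ₗ
    (opLinearEquiv k : B ≃ₗ[k] Bᵐᵒᵖ).toLinearMap)
  have hU (n : N) (x : B) (hx : x ∈ spanMulMul k e) : op x • n ∈ U := by
    induction hx using Submodule.span_induction with
    | mem x hx =>
      obtain ⟨b, b', rfl⟩ := hx
      obtain ⟨y, hy⟩ := hC b'
      rw [mul_assoc, hy, op_mul, mul_smul, Finset.op_sum, Finset.sum_smul]
      refine sum_mem fun c hc => ?_
      rw [op_mul, mul_smul]
      refine Submodule.mem_iSup_of_mem ⟨c, hc⟩ ⟨_, ⟨op (e * y c) • op b • n, rfl⟩, ?_⟩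
      simp [mul_smul]
    | zero => simp
    | add x y _ _ hx hy => rw [MulOpposite.op_add, add_smul]; exact add_mem hx hy
    | smul c x _ hx => rw [op_smul, smul_assoc]; exact Submodule.smul_mem _ _ hx
  have hg (g : N) (hg : g ∈ G) (b : B) : op b • g ∈ U ⊔ V := by
    obtain ⟨x, hx, y, hy, rfl⟩ := Submodule.mem_sup.1
      (hW.sup_eq_top ▸ Submodule.mem_top (x := b) : b ∈ spanMulMul k e ⊔ W)
    rw [MulOpposite.op_add, add_smul]
    exact Submodule.add_mem_sup (hU g x hx) (Submodule.mem_iSup_of_mem ⟨g, hg⟩ ⟨y, hy, rfl⟩)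
  have htop : U ⊔ V = ⊤ := by
    refine eq_top_iff.2 fun n _ => ?_
    have hn : n ∈ Submodule.span Bᵐᵒᵖ (G : Set N) := hG ▸ Submodule.mem_top
    suffices ∀ b : Bᵐᵒᵖ, b • n ∈ U ⊔ V by simpa using this 1
    induction hn using Submodule.span_induction with
    | mem x hx => exact fun b => hg x hx b.unop
    | zero => simp
    | add x y _ _ hx hy => intro b; rw [smul_add]; exact add_mem (hx trivial b) (hy trivial b)
    | smul c x _ hx => intro b; rw [smul_smul]; exact hx trivial _
  have : FiniteDimensional k (⊤ : Submodule k N) := by rw [← htop]; infer_instance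
  exact Module.Finite.equiv (Submodule.topEquiv (R := k) (M := N))

/-- Let `e` be an idempotent of a noetherian algebra `B` such that `B / BeB` is finite
dimensional. If `y e B e` is finite dimensional for all `y` in a right `B`-module, then
so is `y B`. -/
theorem IsIdempotentElem.finiteDimensional_span_singleton [IsNoetherianRing B]
    [IsNoetherianRing Bᵐᵒᵖ] (he : IsIdempotentElem e)
    [FiniteDimensional k (B ⧸ spanMulMul k e)]
    (h : ∀ y : N, FiniteDimensional k
      (Submodule.span k (Set.range fun b : B => op (e * b * e) • y))) (x : N) :
    FiniteDimensional k (Submodule.span Bᵐᵒᵖ {x}) := by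
  -- As xB is cyclic, it suffices to bound (xB)e. Since Be is generated by C as a right eBe-module,
  -- (xB)e lies in the finite sum of the spaces (xc)eBe.
  refine he.finiteDimensional_of_range (e := e) ?_
  obtain ⟨C, hC⟩ := he.exists_finset_eq_mul
  let f : Submodule.span Bᵐᵒᵖ {x} →ₗ[k] N := (Submodule.subtype _).restrictScalars k
  have hf : Function.Injective f := Subtype.val_injective
  let U : Submodule k N := ⨆ c : C, Submodule.span k
    (Set.range fun b : B => op (e * b * e) • op c.1 • x)
  have hU : (LinearMap.range (Algebra.lsmul k k (Submodule.span Bᵐᵒᵖ {x}) (op e))).map f ≤ U := by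
    rintro _ ⟨_, ⟨⟨n, hn⟩, rfl⟩, rfl⟩
    obtain ⟨b, rfl⟩ := Submodule.mem_span_singleton.1 hn
    induction b using MulOpposite.rec' with | _ b
    change op e • op b • x ∈ U
    obtain ⟨y, hy⟩ := hC b
    rw [smul_smul, ← op_mul, hy, Finset.op_sum, Finset.sum_smul]
    refine sum_mem fun c hc => ?_
    rw [op_mul, mul_smul]
    exact Submodule.mem_iSup_of_mem ⟨c, hc⟩ (Submodule.subset_span ⟨y c, rfl⟩)
  have : FiniteDimensional k U := by
    have (c : C) := h (op c.1 • x)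
    infer_instance
  have := Submodule.finiteDimensional_of_le hU
  exact Module.Finite.equiv (Submodule.equivMapOfInjective f hf _).symm

end Idempotent

/-! ### `t`-torsion submodules -/

section TTorsion

open SmashProduct

variable (k : Type u) {A : Type w} {H : Type v} [Field k] [Ring H] [Bialgebra k H]
  [Ring A] [Algebra k A] [Module H A] [IsScalarTower k H A] [IsModuleAlgebra k H A]

theorem isTTorsion_smul_iff {c : k} (hc : c ≠ 0) (t : H) {M : Type*} [AddCommGroup M] [Module k M]
    [Module (SmashProduct k A H)ᵐᵒᵖ M] [IsScalarTower k (SmashProduct k A H)ᵐᵒᵖ M]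
    (N : Submodule (SmashProduct k A H)ᵐᵒᵖ M) : IsTTorsion k (c • t) N ↔ IsTTorsion k t N := by
  have h1 (m : M) (a : A) : op (mk k a (c • t)) • m = op (mk k (c • a) t) • m := by
    simp [← mkₗ_apply]
  have h2 (m : M) : (Set.range fun a : A => op (mk k a (c • t)) • m) =
      Set.range fun a : A => op (mk k a t) • m := by
    simp only [h1]
    exact (LinearEquiv.smulOfNeZero k A c hc).surjective.range_comp
      (fun a : A => op (mk k a t) • m)
  exact forall₂_congr fun m _ => by rw [h2]

variable {k} {M : Type*} [AddCommGroup M] [Module k M]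
    [Module (SmashProduct k A H)ᵐᵒᵖ M] [IsScalarTower k (SmashProduct k A H)ᵐᵒᵖ M]

variable (A M) in
/-- The elements `m` of a right `A # H`-module such that `m (A # t)` is finite dimensional. -/
def integralTorsion {t : H} (ht : IsIntegralElement k t) :
    Submodule (SmashProduct k A H)ᵐᵒᵖ M where
  carrier := {m | FiniteDimensional k
    (Submodule.span k (Set.range fun a : A => op (mk k a t) • m))}
  zero_mem' := by
    have : (Set.range fun a : A => op (mk k a t) • (0 : M)) = {0} := by simp
    rw [Set.mem_ofPred_eq, this, Submodule.span_zero_singleton]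
    infer_instance
  add_mem' {m n} (hm hn : FiniteDimensional k _) := by
    refine Submodule.finiteDimensional_of_le
      (S₂ := Submodule.span k (Set.range fun a : A => op (mk k a t) • m) ⊔
        Submodule.span k (Set.range fun a : A => op (mk k a t) • n)) (Submodule.span_le.2 ?_)
    rintro _ ⟨a, rfl⟩
    dsimp only
    rw [smul_add]
    exact Submodule.add_mem_sup (Submodule.subset_span ⟨a, rfl⟩) (Submodule.subset_span ⟨a, rfl⟩)
  -- A # t is a left ideal, so (mb)(A # t) ⊆ m(A # t).
  smul_mem' b m (hm : FiniteDimensional k _) := by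
    refine Submodule.finiteDimensional_of_le (S₂ := Submodule.span k
      (Set.range fun a : A => op (mk k a t) • m)) (Submodule.span_le.2 ?_)
    rintro _ ⟨a, rfl⟩
    induction b using MulOpposite.rec' with | _ b
    dsimp only
    rw [smul_smul, ← op_mul]
    induction b using SmashProduct.induction with
    | h0 => simp
    | hadd x y hx hy => rw [add_mul, MulOpposite.op_add, add_smul]; exact add_mem hx hy
    | hmk b h =>
      rw [mk_mul_mk_integral k ht]
      exact Submodule.subset_span ⟨_, rfl⟩

/-- The elements satisfying the finiteness condition already form a submodule, which is therefore
the largest `t`-torsion one. -/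
theorem tTorsionSubmodule_eq {t : H} (ht : IsIntegralElement k t) :
    tTorsionSubmodule k A t M = integralTorsion A M ht :=
  le_antisymm (sSup_le fun _ hN m hm => hN m hm) (le_sSup fun _ hm => hm)

/-- T(M) has finitely many generators g because B is right noetherian. As b(1 # e) lies in A # e,
T(M)e is contained in the finite sum of the finite-dimensional spaces g(A # e), and
`finiteDimensional_of_range` applies. -/
theorem finiteDimensional_tTorsionSubmodule [IsNoetherianRing (SmashProduct k A H)]
    [IsNoetherianRing (SmashProduct k A H)ᵐᵒᵖ] {e : H} (he : IsIntegralElement k e)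
    (he1 : Coalgebra.counit (R := k) e = 1)
    [FiniteDimensional k (SmashProduct k A H ⧸ spanMulMul k (mk k (1 : A) e))]
    [Module.Finite (SmashProduct k A H)ᵐᵒᵖ M] :
    FiniteDimensional k (tTorsionSubmodule k A e M) := by
  classical
  rw [tTorsionSubmodule_eq he]
  have hee : IsIdempotentElem (mk k (1 : A) e) := by
    rw [IsIdempotentElem, mk_mul_mk_one, he, he1, one_smul]
  refine hee.finiteDimensional_of_range ?_
  let T := integralTorsion A M he
  obtain ⟨G, hG⟩ := Module.Finite.fg_top (R := (SmashProduct k A H)ᵐᵒᵖ) (M := T)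
  let U : Submodule k M := ⨆ g : G, Submodule.span k
    (Set.range fun a : A => op (mk k a e) • (g.1 : M))
  have : FiniteDimensional k U := by
    have (g : G) : FiniteDimensional k (Submodule.span k
      (Set.range fun a : A => op (mk k a e) • (g.1 : M))) := g.1.2
    infer_instance
  let f : T →ₗ[k] M := (Submodule.subtype _).restrictScalars k
  have hf : Function.Injective f := Subtype.val_injective
  have hU : (LinearMap.range (Algebra.lsmul k k T (op (mk k (1 : A) e)))).map f ≤ U := by
    rintro _ ⟨_, ⟨n, rfl⟩, rfl⟩
    have hn : n ∈ Submodule.span (SmashProduct k A H)ᵐᵒᵖ (G : Set T) := hG ▸ Submodule.mem_top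
    change op (mk k (1 : A) e) • (n : M) ∈ U
    -- All a are needed: acting by b replaces a by b • a.
    suffices ∀ a : A, op (mk k a e) • (n : M) ∈ U from this 1
    induction hn using Submodule.span_induction with
    | mem x hx => exact fun a => Submodule.mem_iSup_of_mem ⟨x, hx⟩ (Submodule.subset_span ⟨a, rfl⟩)
    | zero => simp
    | add x y _ _ hx hy => intro a; rw [Submodule.coe_add, smul_add]; exact add_mem (hx a) (hy a)
    | smul b x _ hx =>
      intro a
      rw [Submodule.coe_smul, smul_smul]
      induction b using MulOpposite.rec' with | _ b
      rw [← op_mul]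
      induction b using SmashProduct.induction with
      | h0 => simp
      | hadd x y hx hy => rw [add_mul, MulOpposite.op_add, add_smul]; exact add_mem hx hy
      | hmk b h => rw [mk_mul_mk_integral k he]; exact hx _
  have := Submodule.finiteDimensional_of_le hU
  exact Module.Finite.equiv (Submodule.equivMapOfInjective f hf _).symm

end TTorsion

/-! ### Torsion elements modulo a submodule -/

section TorsionMod

variable (k : Type*) [Field k] {T : Type*} [Ring T] [Algebra k T] {X : Type*} [AddCommGroup X]
  [Module T X]

theorem finiteDimensional_quotient_of_le {I J : Submodule T T} (h : I ≤ J)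
    (hI : FiniteDimensional k (T ⧸ I)) : FiniteDimensional k (T ⧸ J) :=
  Module.Finite.of_surjective ((Submodule.mapQ I J LinearMap.id h).restrictScalars k) fun x => by
    obtain ⟨x, rfl⟩ := Submodule.mkQ_surjective _ x
    exact ⟨I.mkQ x, rfl⟩

/-- The image of `x` in `X / p` generates a finite-dimensional submodule. -/
def TorsionMod (p : Submodule T X) (x : X) : Prop :=
  FiniteDimensional k (T ⧸ p.comap (LinearMap.toSpanSingleton T X x))

variable {k}

theorem TorsionMod.of_mem {p : Submodule T X} {x : X} (hx : x ∈ p) : TorsionMod k p x := by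
  have : p.comap (LinearMap.toSpanSingleton T X x) = ⊤ := by
    ext b
    simpa using p.smul_mem b hx
  rw [TorsionMod, this]
  have := Submodule.Quotient.subsingleton_iff.2 (rfl : (⊤ : Submodule T T) = ⊤)
  infer_instance

/-- Torsion depends only on the ideal of those b with b • x in p, so an inclusion of such ideals
transfers it between modules with no map between them. -/
theorem TorsionMod.mono {p : Submodule T X} {x : X} {Y : Type*} [AddCommGroup Y] [Module T Y]
    {q : Submodule T Y} {y : Y} (h : ∀ b : T, b • x ∈ p → b • y ∈ q) (hx : TorsionMod k p x) :
    TorsionMod k q y :=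
  finiteDimensional_quotient_of_le k (fun b hb => h b hb) hx

/-- The kernel of S → T / (q : φ z) has finite codimension and is contained in (p : z). No
finiteness of T over S is involved. -/
theorem TorsionMod.of_map {S : Type*} [Ring S] [Algebra k S] (ψ : S →ₐ[k] T) {Z : Type*}
    [AddCommGroup Z] [Module S Z] (φ : Z → X) (hφ : ∀ s z, φ (s • z) = ψ s • φ z)
    {p : Submodule S Z} {q : Submodule T X} (hpq : ∀ z, φ z ∈ q → z ∈ p) {z : Z}
    (hz : TorsionMod k q (φ z)) : TorsionMod k p z := by
  let I := (q.comap (LinearMap.toSpanSingleton T X (φ z)))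
  have : FiniteDimensional k (T ⧸ I) := hz
  let g : S →ₗ[k] T ⧸ I := (I.mkQ.restrictScalars k) ∘ₗ ψ.toLinearMap
  have : FiniteDimensional k (S ⧸ LinearMap.ker g) :=
    Module.Finite.equiv g.quotKerEquivRange.symm
  refine Module.Finite.of_surjective (M := S ⧸ LinearMap.ker g) ((LinearMap.ker g).liftQ
    ((Submodule.mkQ (p.comap (LinearMap.toSpanSingleton S Z z))).restrictScalars k) ?_) ?_
  · intro s hs
    have hs' : ψ s ∈ I := (Submodule.Quotient.mk_eq_zero _).1 hs
    have hs' : ψ s • φ z ∈ q := hs'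
    exact (Submodule.Quotient.mk_eq_zero _).2 (hpq _ (by simpa [hφ] using hs'))
  · intro x
    obtain ⟨x, rfl⟩ := Submodule.mkQ_surjective _ x
    exact ⟨Submodule.Quotient.mk x, rfl⟩

theorem finiteDimensional_span_singleton_iff [Module k X] [IsScalarTower k T X] (x : X) :
    FiniteDimensional k (Submodule.span T {x}) ↔ TorsionMod k (⊥ : Submodule T X) x := by
  rw [← LinearMap.range_toSpanSingleton]
  exact Module.Finite.equiv_iff
    ((LinearMap.toSpanSingleton T X x).quotKerEquivRange.restrictScalars k).symm

theorem finiteDimensional_of_torsionMod [Module k X] [IsScalarTower k T X] [Module.Finite T X]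
    (h : ∀ x : X, TorsionMod k (⊥ : Submodule T X) x) : FiniteDimensional k X := by
  obtain ⟨G, hG⟩ := Module.Finite.fg_top (R := T) (M := X)
  let U : Submodule k X := ⨆ g : G, (Submodule.span T {g.1}).restrictScalars k
  have : FiniteDimensional k U := by
    have (g : G) : FiniteDimensional k ((Submodule.span T {g.1}).restrictScalars k) :=
      (finiteDimensional_span_singleton_iff g.1).2 (h g)
    infer_instance
  have hU : U = ⊤ := by
    refine eq_top_iff.2 fun x _ => ?_
    have hx : x ∈ Submodule.span T (G : Set X) := hG ▸ Submodule.mem_top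
    suffices ∀ b : T, b • x ∈ U by simpa using this 1
    induction hx using Submodule.span_induction with
    | mem x hx =>
      exact fun b => Submodule.mem_iSup_of_mem ⟨x, hx⟩
        (Submodule.smul_mem _ b (Submodule.mem_span_singleton_self x))
    | zero => simp
    | add x y _ _ hx hy =>
      intro b; rw [smul_add]; exact add_mem (hx trivial b) (hy trivial b)
    | smul c x _ hx => intro b; rw [smul_smul]; exact hx trivial _
  rw [hU] at this
  exact Module.Finite.equiv (Submodule.topEquiv (R := k) (M := X))

/-- In the cyclic module generated by x, the kernel of g is finitely generated by noetherianity and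
consists of images of torsion elements, hence is finite dimensional; so is the image in Z. -/
theorem torsionMod_of_exact [IsNoetherianRing T] [Module k X] [IsScalarTower k T X] {Y Z : Type*}
    [AddCommGroup Y] [Module T Y] [AddCommGroup Z] [Module k Z] [Module T Z] [IsScalarTower k T Z]
    (f : Y →ₗ[T] X) (g : X →ₗ[T] Z) (hfg : ∀ x, g x = 0 → x ∈ LinearMap.range f)
    (hY : ∀ y : Y, TorsionMod k (⊥ : Submodule T Y) y)
    (hZ : ∀ z : Z, TorsionMod k (⊥ : Submodule T Z) z) (x : X) :
    TorsionMod k (⊥ : Submodule T X) x := by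
  rw [← finiteDimensional_span_singleton_iff]
  let C := Submodule.span T {x}
  let g' : C →ₗ[T] Z := g ∘ₗ C.subtype
  have : FiniteDimensional k (LinearMap.ker g') := finiteDimensional_of_torsionMod fun c => by
    obtain ⟨y, hy⟩ := hfg c.1 c.2
    refine (hY y).mono fun b hb => ?_
    have hb' : b • y = 0 := hb
    refine Subtype.ext (Subtype.ext ?_)
    change b • (c.1 : X) = 0
    rw [← hy, ← map_smul, hb', map_zero]
  have : FiniteDimensional k (LinearMap.range g') := finiteDimensional_of_torsionMod fun c =>
    (hZ c.1).mono fun b hb => Subtype.ext hb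
  have : FiniteDimensional k (C ⧸ LinearMap.ker g') :=
    Module.Finite.equiv (g'.quotKerEquivRange.restrictScalars k).symm
  have : FiniteDimensional k (C ⧸ (LinearMap.ker g').restrictScalars k) := this
  have : FiniteDimensional k ((LinearMap.ker g').restrictScalars k) :=
    ‹FiniteDimensional k (LinearMap.ker g')›
  exact Module.Finite.of_submodule_quotient ((LinearMap.ker g').restrictScalars k)

end TorsionMod

/-! ### The Serre class of torsion modules -/

section Serre

open scoped ModuleCat

variable (k : Type u) (E : Type v) [Field k] [Ring E] [Algebra k E]

variable {E} in
theorem torsionModules_iff (M : ModuleCat.{w} Eᵐᵒᵖ) :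
    torsionModules k E M ↔ ∀ m : M, TorsionMod k (⊥ : Submodule Eᵐᵒᵖ M) m :=
  forall_congr' fun m => finiteDimensional_span_singleton_iff m

variable {k E} in
theorem torsionModules_of_injective {M N : ModuleCat.{w} Eᵐᵒᵖ} (f : M →ₗ[Eᵐᵒᵖ] N)
    (hf : Function.Injective f) (hN : torsionModules k E N) : torsionModules k E M := by
  rw [torsionModules_iff] at hN ⊢
  exact fun m => (hN (f m)).mono fun b hb => hf (by simpa using hb)

variable {k E} in
theorem torsionModules_of_surjective {M N : ModuleCat.{w} Eᵐᵒᵖ} (f : M →ₗ[Eᵐᵒᵖ] N)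
    (hf : Function.Surjective f) (hM : torsionModules k E M) : torsionModules k E N := by
  rw [torsionModules_iff] at hM ⊢
  intro n
  obtain ⟨m, rfl⟩ := hf n
  refine (hM m).mono fun b hb => ?_
  rw [Submodule.mem_bot] at hb ⊢
  rw [← map_smul, hb, map_zero]

/-- Elementwise form, with no categorical kernels and cokernels, in which torsion is transferred
between B and R. -/
theorem isoModTorsion_iff {M N : ModuleCat.{w} Eᵐᵒᵖ} (f : M ⟶ N) :
    isoModTorsion k E f ↔ (∀ m : M, f.hom m = 0 → TorsionMod k (⊥ : Submodule Eᵐᵒᵖ M) m) ∧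
      ∀ n : N, TorsionMod k (LinearMap.range f.hom) n := by
  have h1 : torsionModules k E (kernel f) ↔
      ∀ m : M, f.hom m = 0 → TorsionMod k (⊥ : Submodule Eᵐᵒᵖ M) m := by
    let i := (ModuleCat.kernelIsoKer f).toLinearEquiv
    have : torsionModules k E (kernel f) ↔
        torsionModules k E (ModuleCat.of Eᵐᵒᵖ (LinearMap.ker f.hom)) :=
      ⟨torsionModules_of_injective i.symm.toLinearMap i.symm.injective,
        torsionModules_of_injective i.toLinearMap i.injective⟩
    rw [this, torsionModules_iff]
    exact ⟨fun h m hm => (h ⟨m, hm⟩).mono fun b hb => (Subtype.ext_iff.1 hb : b • m = 0),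
      fun h m => (h m.1 m.2).mono fun b hb => Subtype.ext hb⟩
  have h2 : torsionModules k E (cokernel f) ↔
      ∀ n : N, TorsionMod k (LinearMap.range f.hom) n := by
    let i := (ModuleCat.cokernelIsoRangeQuotient f).toLinearEquiv
    have : torsionModules k E (cokernel f) ↔
        torsionModules k E (ModuleCat.of Eᵐᵒᵖ (N ⧸ LinearMap.range f.hom)) :=
      ⟨torsionModules_of_injective i.symm.toLinearMap i.symm.injective,
        torsionModules_of_injective i.toLinearMap i.injective⟩
    rw [this, torsionModules_iff]
    refine ⟨fun h n => (h (Submodule.Quotient.mk n)).mono fun b hb =>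
      (Submodule.Quotient.mk_eq_zero _).1 hb, fun h n => ?_⟩
    obtain ⟨n, rfl⟩ := Submodule.mkQ_surjective _ n
    exact (h n).mono fun b hb => (Submodule.Quotient.mk_eq_zero _).2 hb
  exact and_congr h1 h2

/-- Noetherianity enters only through extensions. The Serre property ensures that a morphism
inverted in `QMod` has torsion kernel and cokernel. -/
theorem torsionModules_isSerreClass [IsNoetherianRing Eᵐᵒᵖ] :
    (torsionModules.{u, v, w} k E).IsSerreClass where
  exists_zero := ⟨ModuleCat.of Eᵐᵒᵖ PUnit, ModuleCat.isZero_of_subsingleton _, by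
    rw [torsionModules_iff]
    exact fun m => .of_mem (Subsingleton.elim _ _)⟩
  prop_of_mono f _ hY :=
    torsionModules_of_injective f.hom ((ModuleCat.mono_iff_injective f).1 ‹_›) hY
  prop_of_epi f _ hX :=
    torsionModules_of_surjective f.hom ((ModuleCat.epi_iff_surjective f).1 ‹_›) hX
  prop_X₂_of_shortExact {S} hS h₁ h₃ := by
    rw [torsionModules_iff] at h₁ h₃ ⊢
    exact torsionMod_of_exact S.f.hom S.g.hom
      ((ShortComplex.moduleCat_exact_iff S).1 hS.exact) h₁ h₃

end Serre

noncomputable section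

/-! ### The tensor functor to modules over the invariants -/

namespace SmashProduct

open scoped ModuleCat

section

variable (k : Type u) {H : Type v} {A : Type v} [Field k] [Ring H] [Bialgebra k H]
  [Ring A] [Algebra k A] [Module H A] [IsScalarTower k H A] [IsModuleAlgebra k H A]

theorem mk_add_left (a a' : A) (h : H) : mk k (a + a') h = mk k a h + mk k a' h :=
  TensorProduct.add_tmul _ _ _

theorem mk_smul_left (c : k) (a : A) (h : H) : mk k (c • a) h = c • mk k a h :=
  (TensorProduct.smul_tmul' _ _ _).symm

theorem mul_mk_integral {e : H} (he : IsIntegralElement k e) (b : SmashProduct k A H) (a : A) :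
    b * mk k a e = mk k (b • a) e := by
  induction b using SmashProduct.induction with
  | h0 => simp [← mkₗ_apply]
  | hadd x y hx hy => rw [add_mul, hx, hy, add_smul]; simp [← mkₗ_apply]
  | hmk b h => exact mk_mul_mk_integral k he b a h

theorem mk_mul_mk_invariant (a : A) (h : H) (r : invariantSubalgebra k H A) :
    mk k a h * mk k (r : A) 1 = mk k (a * r) h := by
  let s := Coalgebra.Repr.arbitrary k h
  rw [mk_mul_mk_repr k s]
  conv_rhs => rw [← Coalgebra.sum_counit_smul s]
  have hr (h : H) : h • (r : A) = Coalgebra.counit (R := k) h • (r : A) := r.2 h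
  simp only [hr, mul_one, ← mkₗ_apply, map_sum, map_smul, LinearMap.smul_apply, mul_smul_comm]

variable (A) in
/-- The inclusion `r ↦ r # 1` of the invariants in the smash product, on opposite algebras. -/
def invariantInclusionOp :
    (invariantSubalgebra k H A)ᵐᵒᵖ →ₐ[k] (SmashProduct k A H)ᵐᵒᵖ :=
  AlgHom.op
    { toFun r := mk k (r : A) 1
      map_one' := rfl
      map_zero' := by simp [← mkₗ_apply]
      map_add' a b := by simp [← mkₗ_apply]
      map_mul' a b := by simp [mk_one_mul_mk]
      commutes' c := by
        change mk k (algebraMap k A c) 1 = _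
        rw [Algebra.algebraMap_eq_smul_one, Algebra.algebraMap_eq_smul_one, one_def]
        simp [← mkₗ_apply] }

theorem invariantInclusionOp_op (r : invariantSubalgebra k H A) :
    invariantInclusionOp k A (op r) = op (mk k (r : A) (1 : H)) := rfl

theorem integral_smul_mem {e : H} (he : IsIntegralElement k e) (a : A) :
    e • a ∈ invariantSubalgebra k H A := fun h => by
  rw [← mul_smul, he, smul_assoc]

variable (H A)

/-- The functor `- ⊗_B A` from right modules over `B = A # H` to right modules over `A^H`. -/
abbrev invariantsFunctor : ModuleCat.{v} (SmashProduct k A H)ᵐᵒᵖ ⥤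
    ModuleCat.{v} (invariantSubalgebra k H A)ᵐᵒᵖ :=
  tensorFunctor k (SmashProduct k A H) (invariantSubalgebra k H A) A

variable {H A}

/-- The pure tensor `m ⊗ a` in `M ⊗_B A`. -/
def pureTensor {M : ModuleCat.{v} (SmashProduct k A H)ᵐᵒᵖ} (m : M) (a : A) :
    (invariantsFunctor k H A).obj M :=
  BalancedTensor.tmul k (SmashProduct k A H) m a

@[elab_as_elim]
theorem pureTensor_induction {M : ModuleCat.{v} (SmashProduct k A H)ᵐᵒᵖ}
    {p : (invariantsFunctor k H A).obj M → Prop} (zero : p 0) (tmul : ∀ m a, p (pureTensor k m a))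
    (add : ∀ x y, p x → p y → p (x + y)) (x : (invariantsFunctor k H A).obj M) : p x :=
  BalancedTensor.induction zero tmul add x

theorem op_smul_pureTensor {M : ModuleCat.{v} (SmashProduct k A H)ᵐᵒᵖ} (m : M) (a : A)
    (r : invariantSubalgebra k H A) :
    op r • pureTensor k m a = pureTensor k m (a * (r : A)) := rfl

theorem smul_pureTensor {M : ModuleCat.{v} (SmashProduct k A H)ᵐᵒᵖ} (m : M) (a : A)
    (b : SmashProduct k A H) :
    pureTensor k (op b • m) a = pureTensor k m (b • a) :=
  BalancedTensor.tmul_balanced k _ m b a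

theorem pureTensor_zero {M : ModuleCat.{v} (SmashProduct k A H)ᵐᵒᵖ} (a : A) :
    pureTensor k (0 : M) a = 0 :=
  (congrArg (BalancedTensor.proj k _ M A) (TensorProduct.zero_tmul M a)).trans (map_zero _)

theorem pureTensor_add {M : ModuleCat.{v} (SmashProduct k A H)ᵐᵒᵖ} (m m' : M) (a : A) :
    pureTensor k (m + m') a = pureTensor k m a + pureTensor k m' a :=
  (congrArg (BalancedTensor.proj k _ M A) (TensorProduct.add_tmul m m' a)).trans (map_add _ _ _)

theorem invariantsFunctor_map_pureTensor {M N : ModuleCat.{v} (SmashProduct k A H)ᵐᵒᵖ} (f : M ⟶ N)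
    (m : M) (a : A) :
    ((invariantsFunctor k H A).map f).hom (pureTensor k m a) = pureTensor k (f.hom m) a := rfl

/-- The map `M ⊗_B A → M`, `m ⊗ a ↦ m (a # e)`, for an integral `e`. -/
def tensorToModule {e : H} (he : IsIntegralElement k e)
    (M : ModuleCat.{v} (SmashProduct k A H)ᵐᵒᵖ) : (invariantsFunctor k H A).obj M →+ M :=
  (BalancedTensor.lift k (SmashProduct k A H) (LinearMap.mk₂ k
    (fun (m : M) (a : A) => op (mk k a e) • m)
    (fun m m' a => smul_add _ _ _) (fun c m a => smul_comm _ _ _)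
    (fun m a a' => by rw [mk_add_left, MulOpposite.op_add, add_smul])
    (fun c m a => by rw [mk_smul_left, op_smul, smul_assoc]))
    (fun m b a => by
      change op (mk k a e) • op b • m = op (mk k (b • a) e) • m
      rw [smul_smul, ← op_mul, mul_mk_integral k he]) :
    BalancedTensor k (SmashProduct k A H) M A →ₗ[k] M).toAddMonoidHom

variable {k} {e : H} (he : IsIntegralElement k e)

@[simp] theorem tensorToModule_pureTensor (M : ModuleCat.{v} (SmashProduct k A H)ᵐᵒᵖ) (m : M)
    (a : A) : tensorToModule k he M (pureTensor k m a) = op (mk k a e) • m := rfl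

theorem tensorToModule_smul (M : ModuleCat.{v} (SmashProduct k A H)ᵐᵒᵖ)
    (r : (invariantSubalgebra k H A)ᵐᵒᵖ) (z : (invariantsFunctor k H A).obj M) :
    tensorToModule k he M (r • z) = invariantInclusionOp k A r • tensorToModule k he M z := by
  induction r using MulOpposite.rec' with | _ r
  induction z using pureTensor_induction with
  | zero => simp
  | add x y hx hy => rw [smul_add, map_add, map_add, hx, hy, smul_add]
  | tmul m a =>
    rw [op_smul_pureTensor, tensorToModule_pureTensor, tensorToModule_pureTensor,
      invariantInclusionOp_op, smul_smul, ← op_mul, mk_mul_mk_invariant]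

theorem tensorToModule_naturality {M N : ModuleCat.{v} (SmashProduct k A H)ᵐᵒᵖ} (f : M ⟶ N)
    (z : (invariantsFunctor k H A).obj M) :
    tensorToModule k he N (((invariantsFunctor k H A).map f).hom z) =
      f.hom (tensorToModule k he M z) := by
  induction z using pureTensor_induction with
  | zero => simp
  | add x y hx hy => simp only [map_add, hx, hy]
  | tmul m a =>
    rw [invariantsFunctor_map_pureTensor, tensorToModule_pureTensor, tensorToModule_pureTensor,
      map_smul]

/-- m(a # e) ⊗ 1 = m ⊗ (a # e) • 1 = m ⊗ a, because e • 1 = 1. With `smul_tensorToModule` this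
identifies M ⊗_B A with Me. -/
theorem pureTensor_tensorToModule (he1 : Coalgebra.counit (R := k) e = 1)
    (M : ModuleCat.{v} (SmashProduct k A H)ᵐᵒᵖ)
    (z : (invariantsFunctor k H A).obj M) : pureTensor k (tensorToModule k he M z) 1 = z := by
  induction z using pureTensor_induction with
  | zero => rw [map_zero, pureTensor_zero]
  | add x y hx hy => rw [map_add, pureTensor_add, hx, hy]
  | tmul m a =>
    rw [tensorToModule_pureTensor, smul_pureTensor, smul_def, actₗ_mk,
      IsModuleAlgebra.smul_one' (k := k), he1, one_smul, mul_one]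

theorem tensorToModule_injective (he1 : Coalgebra.counit (R := k) e = 1)
    (M : ModuleCat.{v} (SmashProduct k A H)ᵐᵒᵖ) :
    Function.Injective (tensorToModule k he M) :=
  Function.LeftInverse.injective (g := fun m => pureTensor k m 1)
    (pureTensor_tensorToModule he he1 M)

theorem smul_tensorToModule (he1 : Coalgebra.counit (R := k) e = 1)
    (M : ModuleCat.{v} (SmashProduct k A H)ᵐᵒᵖ)
    (z : (invariantsFunctor k H A).obj M) :
    op (mk k (1 : A) e) • tensorToModule k he M z = tensorToModule k he M z := by
  rw [← tensorToModule_pureTensor he, pureTensor_tensorToModule he he1]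

/-- M ⊗_B A embeds in M semilinearly along R → B, so B-torsion in M restricts to R-torsion by
`TorsionMod.of_map`. Density plays no role in this direction. -/
theorem isoModTorsion_map_invariantsFunctor (he : IsIntegralElement k e)
    (he1 : Coalgebra.counit (R := k) e = 1)
    {M N : ModuleCat.{v} (SmashProduct k A H)ᵐᵒᵖ}
    {f : M ⟶ N} (hf : isoModTorsion k _ f) :
    isoModTorsion k _ ((invariantsFunctor k H A).map f) := by
  rw [isoModTorsion_iff] at hf ⊢
  constructor
  · intro z hz
    refine TorsionMod.of_map (invariantInclusionOp k A) (tensorToModule k he M)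
      (tensorToModule_smul he M) (q := ⊥) (fun z hz => ?_) (hf.1 _ ?_)
    · exact tensorToModule_injective he he1 M (hz.trans (map_zero _).symm)
    · rw [← tensorToModule_naturality, hz, map_zero]
  · intro z
    refine TorsionMod.of_map (invariantInclusionOp k A) (tensorToModule k he N)
      (tensorToModule_smul he N) (q := LinearMap.range f.hom) (fun z hz => ?_) (hf.2 _)
    obtain ⟨m, hm⟩ := hz
    -- If f(m) is the image of z, then so is f(me), since e fixes that image; and me comes from m ⊗
    -- 1.
    refine ⟨pureTensor k m 1, tensorToModule_injective he he1 N ?_⟩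
    rw [tensorToModule_naturality, tensorToModule_pureTensor, map_smul, hm,
      smul_tensorToModule he he1]

theorem invariantsFunctor_isInvertedBy (he : IsIntegralElement k e)
    (he1 : Coalgebra.counit (R := k) e = 1) :
    (isoModTorsion.{u, v, v} k (SmashProduct k A H)).IsInvertedBy
      (invariantsFunctor k H A ⋙ QMod.proj.{u, v, v} k (invariantSubalgebra k H A)) :=
  fun _ _ _ hf => Localization.inverts (QMod.proj.{u, v, v} k (invariantSubalgebra k H A)) _ _
    (isoModTorsion_map_invariantsFunctor he he1 hf)

/-- The corner eBe is covered by R through r ↦ r # e; here r = e • (b • 1). -/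
theorem exists_integral_mul_mul_integral (he : IsIntegralElement k e) (b : SmashProduct k A H) :
    ∃ r : invariantSubalgebra k H A, mk k (1 : A) e * b * mk k (1 : A) e = mk k (r : A) e := by
  refine ⟨⟨_, integral_smul_mem k he (b • (1 : A))⟩, ?_⟩
  rw [mul_assoc, mul_mk_integral k he, mul_mk_integral k he, smul_def, actₗ_mk, one_mul]

end

section


variable (k : Type u) {H : Type v} {A : Type v} [Field k] [Ring H] [Bialgebra k H]
  [Ring A] [Algebra k A] [Module H A] [IsScalarTower k H A] [IsModuleAlgebra k H A]

/-! ### Reflection of torsion along - ⊗_B A -/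

variable {k} in
theorem isIdempotentElem_integral {e : H} (he : IsIntegralElement k e)
    (he1 : Coalgebra.counit (R := k) e = 1) : IsIdempotentElem (mk k (1 : A) e) := by
  rw [IsIdempotentElem, mk_mul_mk_one, he, he1, one_smul]

-- y·eBe is a quotient of R / I, which turns R-torsion of y ⊗ 1 into finiteness of y·eBe.
variable {k} in
theorem finiteDimensional_span_corner {e : H} (he : IsIntegralElement k e) {N : Type*}
    [AddCommGroup N] [Module k N] [Module (SmashProduct k A H)ᵐᵒᵖ N]
    [IsScalarTower k (SmashProduct k A H)ᵐᵒᵖ N] (y : N)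
    (I : Submodule (invariantSubalgebra k H A)ᵐᵒᵖ (invariantSubalgebra k H A)ᵐᵒᵖ)
    (hI : ∀ r : invariantSubalgebra k H A, op r ∈ I → op (mk k (r : A) e) • y = 0)
    (h : FiniteDimensional k ((invariantSubalgebra k H A)ᵐᵒᵖ ⧸ I)) :
    FiniteDimensional k (Submodule.span k (Set.range fun b : SmashProduct k A H =>
      op (mk k (1 : A) e * b * mk k (1 : A) e) • y)) := by
  let f : (invariantSubalgebra k H A)ᵐᵒᵖ →ₗ[k] N :=
    { toFun r := op (mk k (r.unop : A) e) • y
      map_add' r s := by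
        rw [MulOpposite.unop_add, Subalgebra.coe_add, mk_add_left, MulOpposite.op_add, add_smul]
      map_smul' c r := by
        rw [unop_smul, Subalgebra.coe_smul, mk_smul_left, op_smul, smul_assoc, RingHom.id_apply] }
  let g : ((invariantSubalgebra k H A)ᵐᵒᵖ ⧸ I.restrictScalars k) →ₗ[k] N :=
    (I.restrictScalars k).liftQ f fun r hr => hI r.unop hr
  have : FiniteDimensional k ((invariantSubalgebra k H A)ᵐᵒᵖ ⧸ I.restrictScalars k) := h
  refine Submodule.finiteDimensional_of_le (S₂ := LinearMap.range g) (Submodule.span_le.2 ?_)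
  rintro _ ⟨b, rfl⟩
  obtain ⟨r, hr⟩ := exists_integral_mul_mul_integral he b
  dsimp only
  rw [hr]
  exact ⟨Submodule.Quotient.mk (op r), rfl⟩

variable {k}

/-- For every y in the kernel or cokernel of f, R-torsion of y ⊗ 1 bounds y·eBe. Finiteness of B /
BeB then bounds each cyclic submodule through `finiteDimensional_span_singleton`. -/
theorem isoModTorsion_of_map_invariantsFunctor {e : H} (he : IsIntegralElement k e)
    (he1 : Coalgebra.counit (R := k) e = 1)
    [IsNoetherianRing (SmashProduct k A H)] [IsNoetherianRing (SmashProduct k A H)ᵐᵒᵖ]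
    [FiniteDimensional k (SmashProduct k A H ⧸ spanMulMul k (mk k (1 : A) e))]
    {M N : ModuleCat.{v} (SmashProduct k A H)ᵐᵒᵖ} {f : M ⟶ N}
    (hf : isoModTorsion k _ ((invariantsFunctor k H A).map f)) : isoModTorsion k _ f := by
  rw [isoModTorsion_iff] at hf ⊢
  have hee := isIdempotentElem_integral (A := A) he he1
  constructor
  · intro m hm
    have key (y : LinearMap.ker f.hom) := finiteDimensional_span_corner he y _ (fun r hr => ?_)
      (hf.1 (pureTensor k (y : M) 1) (by
        rw [invariantsFunctor_map_pureTensor, y.2, pureTensor_zero]))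
    · have := hee.finiteDimensional_span_singleton key ⟨m, hm⟩
      rw [finiteDimensional_span_singleton_iff] at this
      exact this.mono fun b hb => (Subtype.ext_iff.1 hb : b • m = 0)
    · have hr' : op r • pureTensor k (y : M) (1 : A) = 0 := hr
      rw [op_smul_pureTensor, one_mul] at hr'
      have := congrArg (tensorToModule k he M) hr'
      rw [tensorToModule_pureTensor, map_zero] at this
      exact Subtype.ext this
  · intro n
    have key (y : N ⧸ LinearMap.range f.hom) : FiniteDimensional k
        (Submodule.span k (Set.range fun b : SmashProduct k A H =>
          op (mk k (1 : A) e * b * mk k (1 : A) e) • y)) := by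
      obtain ⟨y, rfl⟩ := Submodule.mkQ_surjective _ y
      refine finiteDimensional_span_corner he _ _ (fun r hr => ?_) (hf.2 (pureTensor k y 1))
      obtain ⟨z, hz⟩ : op r • pureTensor k y (1 : A) ∈
        LinearMap.range ((invariantsFunctor k H A).map f).hom := hr
      rw [op_smul_pureTensor, one_mul] at hz
      have := congrArg (tensorToModule k he N) hz
      rw [tensorToModule_pureTensor, tensorToModule_naturality] at this
      rw [← map_smul]
      exact (Submodule.Quotient.mk_eq_zero _).2 ⟨_, this⟩
    have := hee.finiteDimensional_span_singleton key (Submodule.Quotient.mk n)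
    rw [finiteDimensional_span_singleton_iff] at this
    exact this.mono fun b hb => (Submodule.Quotient.mk_eq_zero _).1 hb

/-! ### The right adjoint Hom_R(A, -) -/

variable (k H A)

instance smulCommClass_invariants_op :
    SMulCommClass (SmashProduct k A H) (invariantSubalgebra k H A)ᵐᵒᵖ A := SMulCommClass.symm _ _ _

variable {H A} in
/-- Left multiplication by `b ∈ A # H` on `A` as an endomorphism of the right `A^H`-module `A`. -/
def leftMul (b : SmashProduct k A H) : A →ₗ[(invariantSubalgebra k H A)ᵐᵒᵖ] A :=
  DistribSMul.toLinearMap _ A b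

/-- The right `A # H`-module `Hom_{A^H}(A, N)`, with `(φ b)(a) = φ(b a)`. -/
abbrev homModule (N : Type*) [AddCommGroup N] [Module (invariantSubalgebra k H A)ᵐᵒᵖ N] :
    Module (SmashProduct k A H)ᵐᵒᵖ (A →ₗ[(invariantSubalgebra k H A)ᵐᵒᵖ] N) where
  smul b φ := φ ∘ₗ leftMul k b.unop
  one_smul φ := LinearMap.ext fun a => congrArg φ (one_smul _ a)
  mul_smul b c φ := LinearMap.ext fun a => congrArg φ (mul_smul c.unop b.unop a)
  smul_zero _ := LinearMap.zero_comp _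
  smul_add _ _ _ := LinearMap.add_comp _ _ _
  add_smul b c φ := LinearMap.ext fun a =>
    (congrArg φ (add_smul b.unop c.unop a)).trans (map_add φ _ _)
  zero_smul φ := LinearMap.ext fun a =>
    (congrArg φ (zero_smul (SmashProduct k A H) a)).trans (map_zero φ)

/-- The functor `Hom_{A^H}(A, -)` from right `A^H`-modules to right `A # H`-modules. -/
def homFunctor : ModuleCat.{v} (invariantSubalgebra k H A)ᵐᵒᵖ ⥤
    ModuleCat.{v} (SmashProduct k A H)ᵐᵒᵖ where
  obj N :=
    letI := homModule k H A N
    ModuleCat.of (SmashProduct k A H)ᵐᵒᵖ (A →ₗ[(invariantSubalgebra k H A)ᵐᵒᵖ] N)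
  map {N N'} f :=
    letI := homModule k H A N
    letI := homModule k H A N'
    ModuleCat.ofHom
      { toFun := fun φ => f.hom ∘ₗ φ
        map_add' := fun _ _ => LinearMap.comp_add _ _ _
        map_smul' := fun _ _ => rfl }

/-- The element of `Hom_{A^H}(A, N)` given by a linear map. -/
def toHomFunctor {N : ModuleCat.{v} (invariantSubalgebra k H A)ᵐᵒᵖ}
    (φ : A →ₗ[(invariantSubalgebra k H A)ᵐᵒᵖ] N) : (homFunctor k H A).obj N := φ

variable {k H A}

/-- The linear map underlying an element of `Hom_{A^H}(A, N)`. -/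
def ofHomFunctor {N : ModuleCat.{v} (invariantSubalgebra k H A)ᵐᵒᵖ}
    (φ : (homFunctor k H A).obj N) : A →ₗ[(invariantSubalgebra k H A)ᵐᵒᵖ] N := φ

theorem ofHomFunctor_smul {N : ModuleCat.{v} (invariantSubalgebra k H A)ᵐᵒᵖ}
    (φ : (homFunctor k H A).obj N) (b : SmashProduct k A H) (a : A) :
    ofHomFunctor (op b • φ) a = ofHomFunctor φ (b • a) := rfl

/-- On the left the scalar acts through A # H, on the right through A^H; linearity of φ over k
reconciles the two. -/
theorem ofHomFunctor_k_smul {N : ModuleCat.{v} (invariantSubalgebra k H A)ᵐᵒᵖ}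
    (φ : (homFunctor k H A).obj N) (c : k) (a : A) :
    ofHomFunctor (c • φ) a = c • ofHomFunctor φ a := by
  rw [← LinearMap.map_smul_of_tower, ← algebraMap_smul (SmashProduct k A H) c a,
    ← ofHomFunctor_smul]
  congr 1

variable (k H A)

/-- The unit of the adjunction between `- ⊗_B A` and `Hom_{A^H}(A, -)`. -/
def tensorHomUnit : 𝟭 _ ⟶ invariantsFunctor k H A ⋙ homFunctor k H A where
  app M := ModuleCat.ofHom (Y := (homFunctor k H A).obj ((invariantsFunctor k H A).obj M))
    { toFun := fun m : M => toHomFunctor k H A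
        { toFun := fun a => pureTensor k m a
          map_add' := fun a a' =>
            (congrArg (BalancedTensor.proj k _ M A) (TensorProduct.tmul_add m a a')).trans
              (map_add _ _ _)
          map_smul' := fun _ _ => rfl }
      map_add' := fun m m' => LinearMap.ext fun a => pureTensor_add k m m' a
      map_smul' := fun b m => LinearMap.ext fun a => smul_pureTensor k m a b.unop }

variable {k H A} in
/-- The evaluation map `Hom_{A^H}(A, N) ⊗_B A → N`. -/
def evalMap (N : ModuleCat.{v} (invariantSubalgebra k H A)ᵐᵒᵖ) :
    (invariantsFunctor k H A).obj ((homFunctor k H A).obj N) →+ N :=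
  (BalancedTensor.lift k (SmashProduct k A H) (LinearMap.mk₂ k
    (fun (φ : (homFunctor k H A).obj N) (a : A) => ofHomFunctor φ a)
    (fun _ _ _ => rfl) (fun c φ a => ofHomFunctor_k_smul φ c a)
    (fun _ _ _ => map_add _ _ _) (fun _ _ _ => LinearMap.map_smul_of_tower _ _ _))
    (fun _ _ _ => rfl) :
    BalancedTensor k (SmashProduct k A H) ((homFunctor k H A).obj N) A →ₗ[k] N).toAddMonoidHom

theorem evalMap_smul (N : ModuleCat.{v} (invariantSubalgebra k H A)ᵐᵒᵖ)
    (r : (invariantSubalgebra k H A)ᵐᵒᵖ)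
    (z : (invariantsFunctor k H A).obj ((homFunctor k H A).obj N)) :
    evalMap N (r • z) = r • evalMap N z := by
  induction z using pureTensor_induction with
  | zero => simp
  | add x y hx hy => simp only [smul_add, map_add, hx, hy]
  | tmul φ a => exact map_smul (ofHomFunctor φ) r a

/-- The counit of the adjunction between `- ⊗_B A` and `Hom_{A^H}(A, -)`. -/
def tensorHomCounit : homFunctor k H A ⋙ invariantsFunctor k H A ⟶ 𝟭 _ where
  app N := ModuleCat.ofHom (X := (invariantsFunctor k H A).obj ((homFunctor k H A).obj N))
    { evalMap N with map_smul' := evalMap_smul k H A N }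
  naturality N N' f := by
    ext z
    induction z using pureTensor_induction with
    | zero => simp
    | add x y hx hy => simp only [map_add, hx, hy]
    | tmul φ a => rfl

/-- The adjunction between `- ⊗_B A` and `Hom_{A^H}(A, -)`. -/
def tensorHomAdjunction : invariantsFunctor k H A ⊣ homFunctor k H A where
  unit := tensorHomUnit k H A
  counit := tensorHomCounit k H A
  left_triangle_components M := by
    ext z
    induction z using pureTensor_induction with
    | zero => simp
    | add x y hx hy => simp only [map_add, hx, hy]
    | tmul m a => rfl
  right_triangle_components N := rfl

variable {k H A}

/-- Every tensor is φ ⊗ 1 with φ = φe, and then φ(a) = φ(e • a) = φ(1)(e • a), so φ(1) = 0 forces φ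
= 0. Conversely n is the value at 1 of a ↦ n(e • a). Hence Hom_R(A, -) is fully faithful. -/
theorem isIso_tensorHomCounit {e : H} (he : IsIntegralElement k e)
    (he1 : Coalgebra.counit (R := k) e = 1) : IsIso (tensorHomCounit k H A) := by
  have (N : ModuleCat.{v} (invariantSubalgebra k H A)ᵐᵒᵖ) :
      IsIso ((tensorHomCounit k H A).app N) := by
    rw [ConcreteCategory.isIso_iff_bijective]
    constructor
    · rw [injective_iff_map_eq_zero]
      intro z hz
      rw [← pureTensor_tensorToModule he he1 _ z] at hz ⊢
      have hz' : ofHomFunctor (tensorToModule k he _ z) (1 : A) = 0 := hz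
      have : tensorToModule k he _ z = 0 := by
        rw [← smul_tensorToModule he he1]
        refine LinearMap.ext fun a => ?_
        change ofHomFunctor (op (mk k (1 : A) e) • tensorToModule k he _ z) a = 0
        rw [ofHomFunctor_smul, smul_def, actₗ_mk,
          ← invariant_op_smul k ⟨_, integral_smul_mem k he a⟩, map_smul, hz', smul_zero]
      rw [this, pureTensor_zero]
    · intro n
      let φ : A →ₗ[(invariantSubalgebra k H A)ᵐᵒᵖ] N :=
        { toFun := fun a => op (⟨_, integral_smul_mem k he a⟩ : invariantSubalgebra k H A) • n
          map_add' := fun a a' => by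
            rw [← add_smul, ← MulOpposite.op_add]
            congr 2
            exact Subtype.ext (smul_add e a a')
          map_smul' := fun r a => by
            induction r using MulOpposite.rec' with | _ r
            rw [RingHom.id_apply, smul_smul, ← op_mul]
            congr 2
            exact Subtype.ext (IsModuleAlgebra.smul_mul_of_invariant_right k r.2 e a) }
      refine ⟨pureTensor k (toHomFunctor k H A φ) 1, ?_⟩
      change op (⟨e • (1 : A), _⟩ : invariantSubalgebra k H A) • n = n
      convert one_smul (invariantSubalgebra k H A)ᵐᵒᵖ n
      rw [← op_one]
      congr 1
      exact Subtype.ext (by simp [IsModuleAlgebra.smul_one' (k := k), he1])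
  exact NatIso.isIso_of_isIso_app _

end

end SmashProduct

/-! ### Localization and equivalence of the quotient categories -/

section IsoModTorsion

variable {k : Type u} {E : Type v} [Field k] [Ring E] [Algebra k E]

theorem isoModTorsion_of_isIso {X Y : ModuleCat.{w} Eᵐᵒᵖ} (f : X ⟶ Y) [IsIso f] :
    isoModTorsion k E f := by
  have hf := (ConcreteCategory.isIso_iff_bijective f).1 inferInstance
  rw [isoModTorsion_iff]
  refine ⟨fun m hm => .of_mem ?_, fun n => .of_mem (hf.2 n)⟩
  exact hf.1 (hm.trans (map_zero f.hom).symm)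

theorem isoModTorsion_of_commSq {X Y X' Y' : ModuleCat.{w} Eᵐᵒᵖ} {f : X ⟶ Y} {g : X' ⟶ Y'}
    (α : X ⟶ X') (β : Y ⟶ Y') [IsIso α] [IsIso β] (h : f ≫ β = α ≫ g)
    (hg : isoModTorsion k E g) : isoModTorsion k E f := by
  have hα := (ConcreteCategory.isIso_iff_bijective α).1 inferInstance
  have hβ := (ConcreteCategory.isIso_iff_bijective β).1 inferInstance
  have h' (x : X) : β.hom (f.hom x) = g.hom (α.hom x) := ConcreteCategory.congr_hom h x
  rw [isoModTorsion_iff] at hg ⊢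
  constructor
  · intro x hx
    refine (hg.1 (α.hom x) (by rw [← h', hx, map_zero])).mono fun b hb => hα.1 ?_
    exact (map_smul α.hom b x).trans (hb.trans (map_zero α.hom).symm)
  · intro y
    refine (hg.2 (β.hom y)).mono fun b hb => ?_
    obtain ⟨x', hx'⟩ := hb
    obtain ⟨x, rfl⟩ := hα.2 x'
    exact ⟨x, hβ.1 ((h' x).trans (hx'.trans (map_smul β.hom b y).symm))⟩

end IsoModTorsion

namespace SmashProduct

variable {k : Type u} {H : Type v} {A : Type v} [Field k] [Ring H] [Bialgebra k H]
  [Ring A] [Algebra k A] [Module H A] [IsScalarTower k H A] [IsModuleAlgebra k H A]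
  {e : H}

/-- Having a fully faithful right adjoint, - ⊗_B A is the localization at the morphisms it inverts.
To compose with the projection, these must lie in the class for B, which is reflection of torsion,
and each morphism of the class for R must come from one of the class for B. -/
theorem isLocalization_invariantsFunctor_comp_proj (he : IsIntegralElement k e)
    (he1 : Coalgebra.counit (R := k) e = 1)
    [IsNoetherianRing (SmashProduct k A H)] [IsNoetherianRing (SmashProduct k A H)ᵐᵒᵖ]
    [FiniteDimensional k (SmashProduct k A H ⧸ spanMulMul k (mk k (1 : A) e))] :
    (invariantsFunctor k H A ⋙
      QMod.proj.{u, v, v} k (invariantSubalgebra k H A)).IsLocalization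
        (isoModTorsion.{u, v, v} k (SmashProduct k A H)) := by
  let adj := tensorHomAdjunction k H A
  have : IsIso adj.counit := isIso_tensorHomCounit he he1
  have := adj.fullyFaithfulROfIsIsoCounit.full
  have := adj.fullyFaithfulROfIsIsoCounit.faithful
  have := adj.isLocalization
  refine Functor.IsLocalization.comp _ _
    ((MorphismProperty.isomorphisms _).inverseImage (invariantsFunctor k H A))
    (isoModTorsion.{u, v, v} k (invariantSubalgebra k H A)) _
    (invariantsFunctor_isInvertedBy he he1) ?_ ?_
  · intro M N f hf
    have : IsIso ((invariantsFunctor k H A).map f) := hf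
    exact isoModTorsion_of_map_invariantsFunctor he he1 (isoModTorsion_of_isIso _)
  · intro M N g hg
    -- Up to the counit, g is the image of Hom_R(A, g), which belongs to the class for B by
    -- reflection.
    let i : Arrow.mk ((invariantsFunctor k H A).map ((homFunctor k H A).map g)) ≅ Arrow.mk g :=
      Arrow.isoMk (asIso (adj.counit.app M)) (asIso (adj.counit.app N))
        (adj.counit.naturality g).symm
    refine (MorphismProperty.arrow_mk_iso_iff _ i).1 (MorphismProperty.map_mem_map _ _ _ ?_)
    exact isoModTorsion_of_map_invariantsFunctor he he1
      (isoModTorsion_of_commSq (adj.counit.app M) (adj.counit.app N) (adj.counit.naturality g) hg)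

/-! ### The module B / BeB and the converse direction -/

variable (k) in
/-- The right ideal `BeB` of `B = A # H`. -/
def rightIdeal (e : SmashProduct k A H) :
    Submodule (SmashProduct k A H)ᵐᵒᵖ (SmashProduct k A H)ᵐᵒᵖ where
  carrier := {x | x.unop ∈ spanMulMul k e}
  zero_mem' := zero_mem (spanMulMul k e)
  add_mem' hx hy := (spanMulMul k e).add_mem hx hy
  smul_mem' b _ hx := mul_mem_spanMulMul_right k hx b.unop

theorem finiteDimensional_quotient_rightIdeal_iff (e : SmashProduct k A H) :
    FiniteDimensional k ((SmashProduct k A H)ᵐᵒᵖ ⧸ rightIdeal k e) ↔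
      FiniteDimensional k (SmashProduct k A H ⧸ spanMulMul k e) := by
  refine Module.Finite.equiv_iff (M := (SmashProduct k A H)ᵐᵒᵖ ⧸
    (rightIdeal k e).restrictScalars k) (Submodule.Quotient.equiv _ _ (opLinearEquiv k).symm ?_)
  ext x
  exact ⟨fun ⟨y, hy, h⟩ => h ▸ hy, fun h => ⟨op x, h, rfl⟩⟩

theorem finiteDimensional_of_isEquivalence (he : IsIntegralElement k e)
    (he1 : Coalgebra.counit (R := k) e = 1) [IsNoetherianRing (SmashProduct k A H)ᵐᵒᵖ]
    (hF : (isoModTorsion.{u, v, v} k (SmashProduct k A H)).IsInvertedBy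
        (invariantsFunctor k H A ⋙ QMod.proj.{u, v, v} k (invariantSubalgebra k H A)))
    (h : (Localization.lift (invariantsFunctor k H A ⋙
      QMod.proj.{u, v, v} k (invariantSubalgebra k H A)) hF
        (QMod.proj.{u, v, v} k (SmashProduct k A H))).IsEquivalence) :
    FiniteDimensional k (SmashProduct k A H ⧸ spanMulMul k (mk k (1 : A) e)) := by
  have := torsionModules_isSerreClass.{u, v, v} k (SmashProduct k A H)
  let X : ModuleCat.{v} (SmashProduct k A H)ᵐᵒᵖ :=
    ModuleCat.of _ ((SmashProduct k A H)ᵐᵒᵖ ⧸ rightIdeal k (mk k (1 : A) e))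
  have hX (z : (invariantsFunctor k H A).obj X) : z = 0 := by
    have h0 (x : X) : op (mk k (1 : A) e) • x = 0 := by
      obtain ⟨x, rfl⟩ := Submodule.mkQ_surjective _ x
      refine (Submodule.Quotient.mk_eq_zero _).2 ?_
      change x.unop * mk k (1 : A) e ∈ spanMulMul k _
      simpa using mul_mul_mem_spanMulMul k (mk k (1 : A) e) x.unop 1
    rw [← pureTensor_tensorToModule he he1 X z, ← smul_tensorToModule he he1, h0, pureTensor_zero]
  -- The zero endomorphism lies in the class exactly when X = B / BeB is torsion. Its image under -
  -- ⊗_B A is an isomorphism of zero modules.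
  let f : X ⟶ X := 0
  have hf : IsIso ((invariantsFunctor k H A).map f) := by
    rw [ConcreteCategory.isIso_iff_bijective]
    exact ⟨fun x y _ => (hX x).trans (hX y).symm, fun y => ⟨0, (map_zero _).trans (hX y).symm⟩⟩
  let L := Localization.lift (invariantsFunctor k H A ⋙
      QMod.proj.{u, v, v} k (invariantSubalgebra k H A)) hF
        (QMod.proj.{u, v, v} k (SmashProduct k A H))
  have : L.IsEquivalence := h
  have h1 : IsIso (L.map ((QMod.proj.{u, v, v} k (SmashProduct k A H)).map f)) :=
    (NatIso.isIso_map_iff (Localization.fac (invariantsFunctor k H A ⋙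
      QMod.proj.{u, v, v} k (invariantSubalgebra k H A)) hF
        (QMod.proj.{u, v, v} k (SmashProduct k A H))) f).2
      (inferInstanceAs (IsIso ((QMod.proj.{u, v, v} k (invariantSubalgebra k H A)).map
        ((invariantsFunctor k H A).map f))))
  have h2 : IsIso ((QMod.proj.{u, v, v} k (SmashProduct k A H)).map f) :=
    isIso_of_reflects_iso _ L
  have h3 : isoModTorsion k _ f := (ObjectProperty.SerreClassLocalization.isIso_map_iff
    (torsionModules k (SmashProduct k A H)).isoModSerre.Q
    (torsionModules k (SmashProduct k A H)) f).1 h2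
  rw [isoModTorsion_iff] at h3
  -- The annihilator of the class of 1 is BeB itself, so torsion of this one element is the claim.
  have h4 := h3.1 (Submodule.Quotient.mk 1) rfl
  rw [← finiteDimensional_quotient_rightIdeal_iff]
  refine finiteDimensional_quotient_of_le k (fun b hb => ?_) h4
  have hb' : b • (Submodule.Quotient.mk 1 : X) = 0 := hb
  rwa [← Submodule.Quotient.mk_smul, Submodule.Quotient.mk_eq_zero, smul_eq_mul, mul_one] at hb'

end SmashProduct

/-! ### The equivalence of the four conditions -/

theorem integralIdeal_quotient_iff {k : Type u} {H : Type v} {A : Type w} [Field k] [Ring H]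
    [Bialgebra k H] [Ring A] [Algebra k A] [Module H A] [IsScalarTower k H A]
    [IsModuleAlgebra k H A] {c : k} (hc : c ≠ 0) (e : H) :
    FiniteDimensional k (integralIdeal k A (c • e)).ringCon.Quotient ↔
      FiniteDimensional k
        (SmashProduct k A H ⧸ spanMulMul k (SmashProduct.mk k (1 : A) e)) := by
  rw [integralIdeal, finiteDimensional_ringCon_quotient_iff, ← SmashProduct.mkₗ_apply, map_smul,
    spanMulMul_smul k hc]
  rfl

theorem mainTheorem1 {k : Type u} [Field k] [CharZero k]
    {H : Type v} [Ring H] [HopfAlgebra k H] [FiniteDimensional k H] [IsSemisimpleRing H]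
    {A : Type v} [Ring A] [Algebra k A] [Module H A] [IsScalarTower k H A] [IsModuleAlgebra k H A]
    [IsNoetherianRing A] [IsNoetherianRing Aᵐᵒᵖ]
    (t : H) (ht : IsIntegralElement k t) (ht0 : t ≠ 0) :
    ∃ hF : (isoModTorsion.{u, v, v} k (SmashProduct k A H)).IsInvertedBy
        (tensorFunctor k (SmashProduct k A H) (invariantSubalgebra k H A) A ⋙
          QMod.proj.{u, v, v} k (invariantSubalgebra k H A)),
      List.TFAE [
        IsDenseGalois k H A,
        ∀ (M : Type v) [AddCommGroup M] [Module k M] [Module (SmashProduct k A H)ᵐᵒᵖ M]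
          [IsScalarTower k (SmashProduct k A H)ᵐᵒᵖ M],
          Module.Finite (SmashProduct k A H)ᵐᵒᵖ M →
            FiniteDimensional k (tTorsionSubmodule k A t M),
        FiniteDimensional k (integralIdeal k A t).ringCon.Quotient,
        (Localization.lift
          (tensorFunctor k (SmashProduct k A H) (invariantSubalgebra k H A) A ⋙
            QMod.proj.{u, v, v} k (invariantSubalgebra k H A)) hF
          (QMod.proj.{u, v, v} k (SmashProduct k A H))).IsEquivalence] := by
  obtain ⟨e, he, her, he1⟩ := exists_normalized_integral k H
  have he0 : e ≠ 0 := by rintro rfl; simp at he1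
  have hte := IsIntegralElement.eq_counit_smul her he1 ht
  -- From here on t = c • e with c ≠ 0, and e carries the argument.
  generalize Coalgebra.counit (R := k) t = c at hte
  have hc : c ≠ 0 := by rintro rfl; exact ht0 (by simpa using hte)
  subst hte
  have hl : IsNoetherianRing (SmashProduct k A H) := SmashProduct.isNoetherianRing k A
  have hr : IsNoetherianRing (SmashProduct k A H)ᵐᵒᵖ := SmashProduct.isNoetherianRing_op k A he he0
  refine ⟨SmashProduct.invariantsFunctor_isInvertedBy he he1, ?_⟩
  rw [integralIdeal_quotient_iff hc]
  tfae_have 1 ↔ 3 := SmashProduct.isDenseGalois_iff k A he he0 her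
  tfae_have 3 → 2 := by
    intro h M _ _ _ _ _
    have : tTorsionSubmodule k A (c • e) M = tTorsionSubmodule k A e M :=
      congrArg sSup (Set.ext fun N => isTTorsion_smul_iff k hc e N)
    rw [this]
    exact finiteDimensional_tTorsionSubmodule he he1
  tfae_have 2 → 3 := by
    intro h
    -- The test module is B / BeB: right multiplication by A # t kills it, so it equals its
    -- `t`-torsion part.
    let I := SmashProduct.rightIdeal k (SmashProduct.mk k (1 : A) e)
    have hfin := h ((SmashProduct k A H)ᵐᵒᵖ ⧸ I) inferInstance
    have htop : tTorsionSubmodule k A (c • e) ((SmashProduct k A H)ᵐᵒᵖ ⧸ I) = ⊤ := by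
      refine eq_top_iff.2 (le_sSup fun m _ => ?_)
      have : (Set.range fun a : A => op (SmashProduct.mk k a (c • e)) • m) = {0} := by
        refine Set.eq_singleton_iff_unique_mem.2 ⟨⟨0, ?_⟩, ?_⟩
        · simp [← SmashProduct.mkₗ_apply]
        · rintro _ ⟨a, rfl⟩
          obtain ⟨x, rfl⟩ := Submodule.mkQ_surjective _ m
          refine (Submodule.Quotient.mk_eq_zero _).2 ?_
          change x.unop * SmashProduct.mk k a (c • e) ∈ spanMulMul k _
          -- a # ce = (ca # 1)(1 # e), so x(a # ce) lies in BeB.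
          have := mul_mul_mem_spanMulMul k (SmashProduct.mk k (1 : A) e)
            (x.unop * SmashProduct.mk k (c • a) 1) 1
          rw [mul_one, mul_assoc, SmashProduct.mk_one_mul_mk, mul_one] at this
          convert this using 2
          simp [← SmashProduct.mkₗ_apply]
      rw [this, Submodule.span_zero_singleton]
      infer_instance
    rw [htop] at hfin
    rw [← SmashProduct.finiteDimensional_quotient_rightIdeal_iff]
    exact Module.Finite.equiv ((Submodule.topEquiv
      (R := (SmashProduct k A H)ᵐᵒᵖ) (M := (SmashProduct k A H)ᵐᵒᵖ ⧸ I)).restrictScalars k)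
  tfae_have 3 → 4 := by
    intro h
    have := SmashProduct.isLocalization_invariantsFunctor_comp_proj (A := A) he he1
    -- The induced functor is isomorphic to the canonical equivalence between two localizations of
    -- Mod B at the same class.
    exact Functor.isEquivalence_of_iso (Localization.isoUniqFunctor
      (QMod.proj.{u, v, v} k (SmashProduct k A H)) _
      (isoModTorsion.{u, v, v} k (SmashProduct k A H)) _ (Localization.fac _ _ _)).symm
  tfae_have 4 → 3 := SmashProduct.finiteDimensional_of_isEquivalence he he1 _
  tfae_finish

end
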